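/- Let $s\ge 2$ be an integer and $g=s^2$. Divide $[0,1]$ into the $g$ segments $I_k=[k/g,(k+1)/g]$, $0\le k<g$, and $[0,1]^2$ into the $g$ squares (called $s$-squares) $\left[\frac{j_1}{s},\frac{j_1+1}{s}\right]\times\left[\frac{j_2}{s},\frac{j_2+1}{s}\right]$, $0\le j_1,j_2<s$. A plane Peano monofractal curve of genus $g$ is a continuous surjective map $\gamma\colon[0,1]\to[0,1]^2$ such that, for each $k$, the restriction $\gamma|_{I_k}$ maps $I_k$ to some $s$-square $Q$ and is similar to $\gamma$ with coefficient $s$: there are surjective isometries $\alpha\colon gI_k\to[0,1]$ and $\beta\colon sQ\to[0,1]^2$ with $\beta\bigl(s\,\gamma(t/g)\bigr)=\gamma(\alpha(t))$ for all $t\in gI_k$. For $n\ge1$, the fractions of order $n$ of $\gamma$ are the restrictions of $\gamma$ to the $g^n$ segments $[m/g^n,(m+1)/g^n]$, $0\le m<g^n$; the image of each of them is a square of side $s^{-n}$. The curve $\gamma$ has a diagonal junction if, for some $n\ge1$, there are two consecutive fractions of order $n$ whose images meet only at one point (a common vertex of the two squares). The Euclidean dilation of $\gamma$ is $$\mathrm{WD}_2(\gamma)=\sup_{0\le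 t_1<t_2\le1}\frac{\|\gamma(t_1)-\gamma(t_2)\|_2^2}{t_2-t_1}.$$ Theorem. If a plane Peano monofractal curve $\gamma$ (of any genus $s^2$, $s\ge2$) has a diagonal junction, then $\mathrm{WD}_2(\gamma)\ge 5\frac23=\frac{17}{3}$. -/

import Mathlib

open Set
open scoped Pointwise

/-- The unit cube `[0,1]^d` in Euclidean space. -/
def unitCube (d : ℕ) : Set (EuclideanSpace ℝ (Fin d)) :=
  {x | ∀ i, x i ∈ Icc (0 : ℝ) 1}

/-- The `s`-cube `∏ i, [j i / s, (j i + 1) / s]`, for `0 ≤ j i < s`: one of the `s ^ d` cells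
of the regular grid on the unit cube. -/
def gridCube {d : ℕ} (s : ℕ) (j : Fin d → Fin s) : Set (EuclideanSpace ℝ (Fin d)) :=
  {x | ∀ i, x i ∈ Icc (((j i : ℕ) : ℝ) / s) ((((j i : ℕ) : ℝ) + 1) / s)}

/-- The time segment `[k / g, (k + 1) / g]`. -/
def timeSegment (g k : ℕ) : Set ℝ :=
  Icc ((k : ℝ) / g) (((k : ℝ) + 1) / g)

/-- The curves `γ₁ : I₁ → Q₁` and `γ₂ : I₂ → Q₂` are isometric: there are isometries `α` taking
`I₁` onto `I₂` (time) and `β` taking `Q₁` onto `Q₂` (space) with `β ∘ γ₁ = γ₂ ∘ α` on `I₁`.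
The isometries are given on the ambient Euclidean spaces; an isometry between segments or between
cubes always extends to one of these. -/
def AreIsometricCurves {d : ℕ}
    (γ₁ : ℝ → EuclideanSpace ℝ (Fin d)) (I₁ : Set ℝ) (Q₁ : Set (EuclideanSpace ℝ (Fin d)))
    (γ₂ : ℝ → EuclideanSpace ℝ (Fin d)) (I₂ : Set ℝ) (Q₂ : Set (EuclideanSpace ℝ (Fin d))) :
    Prop :=
  ∃ (α : ℝ ≃ᵢ ℝ) (β : EuclideanSpace ℝ (Fin d) ≃ᵢ EuclideanSpace ℝ (Fin d)),
    α '' I₁ = I₂ ∧ β '' Q₁ = Q₂ ∧ ∀ t ∈ I₁, β (γ₁ t) = γ₂ (α t)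

/-- The curves `γ₁ : I₁ → Q₁` and `γ₂ : I₂ → Q₂` are similar with coefficient `s`: the curve
`t ↦ s γ₁(t / s ^ d)` from `s ^ d I₁` to `s Q₁` is isometric to `γ₂`. -/
def AreSimilarCurves {d : ℕ} (s : ℕ)
    (γ₁ : ℝ → EuclideanSpace ℝ (Fin d)) (I₁ : Set ℝ) (Q₁ : Set (EuclideanSpace ℝ (Fin d)))
    (γ₂ : ℝ → EuclideanSpace ℝ (Fin d)) (I₂ : Set ℝ) (Q₂ : Set (EuclideanSpace ℝ (Fin d))) :
    Prop :=
  AreIsometricCurves (fun t => (s : ℝ) • γ₁ (t / (s : ℝ) ^ d)) (((s : ℝ) ^ d) • I₁) ((s : ℝ) • Q₁)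
    γ₂ I₂ Q₂

/-- `γ : [0,1] → [0,1]^d` is a Peano monofractal of genus `s ^ d`: a continuous surjective curve
each of whose `s ^ d` fractions maps its time segment to some `s`-cube and is similar to `γ` with
coefficient `s`. Only the values of `γ` on `[0,1]` matter. -/
structure IsPeanoMonofractal {d : ℕ} (s : ℕ) (γ : ℝ → EuclideanSpace ℝ (Fin d)) : Prop where
  two_le : 2 ≤ s
  continuousOn : ContinuousOn γ (Icc 0 1)
  image_eq : γ '' Icc 0 1 = unitCube d
  fraction_similar : ∀ k < s ^ d, ∃ j : Fin d → Fin s,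
    MapsTo γ (timeSegment (s ^ d) k) (gridCube s j) ∧
    AreSimilarCurves s γ (timeSegment (s ^ d) k) (gridCube s j) γ (Icc 0 1) (unitCube d)

/-- The `m`-th fraction of order `n` (`0 ≤ m < g ^ n`) of a curve of genus `g`, identified with
its image. -/
def fraction {d : ℕ} (γ : ℝ → EuclideanSpace ℝ (Fin d)) (g n m : ℕ) :
    Set (EuclideanSpace ℝ (Fin d)) :=
  γ '' timeSegment (g ^ n) m

/-- The curve `γ` of genus `g` has a diagonal junction: for some order `n`, two fractions of
order `n` that are consecutive in time meet in a single point. In the plane the fractions are cells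
of a square grid, so that this point is a common vertex. -/
def HasDiagonalJunction (γ : ℝ → EuclideanSpace ℝ (Fin 2)) (g : ℕ) : Prop :=
  ∃ n m : ℕ, 1 ≤ n ∧ m + 1 < g ^ n ∧ ∃ p, fraction γ g n m ∩ fraction γ g n (m + 1) = {p}

/-- The Euclidean dilation `WD₂(γ) = sup_{0 ≤ t₁ < t₂ ≤ 1} ‖γ(t₁) - γ(t₂)‖ ^ d / (t₂ - t₁)`,
as an extended real number. -/
noncomputable def WD₂ {d : ℕ} (γ : ℝ → EuclideanSpace ℝ (Fin d)) : EReal :=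
  ⨆ (t₁ : ℝ) (t₂ : ℝ) (_ : 0 ≤ t₁ ∧ t₁ < t₂ ∧ t₂ ≤ 1),
    ((‖γ t₁ - γ t₂‖ ^ d / (t₂ - t₁) : ℝ) : EReal)

/-!
The image of a fraction of order `n` is a lattice square of side `s⁻ⁿ`, and the fraction is a copy of
the whole curve, placed in this square by one of the eight symmetries and perhaps traversed backwards
(`IsPeanoMonofractal.exists_isFractionCopy`). Distinct fractions fill distinct squares, because there
are as many squares as fractions. At a diagonal junction of order `n` the two squares are diagonal
neighbours. Hence two orders further down the junction is surrounded by 32 consecutive copies of one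
base curve, 16 on either side, and the two halves of this chain lie in opposite quadrants.

Assume that the dilation is less than `17/3`. In units in which a copy has side 1 and takes the time
17, two points of the curve at the distance `d` are then more than `3 d²` apart in time. Choose the
base curve as the copy just after the junction, so that it starts at the vertex `(0, 0)` of the unit
square. It visits the other vertices at some times; those among them that the argument needs are
two unknown times `x` and `y`, besides the end of the base curve if this is a vertex. Each pair of
visits of vertices by two copies in the chain then gives a linear inequality for `x` and `y`, with at
most two unknown terms and coefficients `±1` or `±2`. The end point of the base curve enters only
through the codes of its coordinates (`mark`), which suffice to decide which placements of
consecutive copies fit together. For each code of the end point, a finite search over all chains of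
at most 14 copies around the junction finds a contradiction among these inequalities in all branches
(`refutes_diagonal`, `refutes_side`, `refutes_side'`, `refutes_general`). An exchange of the
coordinates removes the need to consider the other orders of visits.

The search is evaluated by the kernel. Its soundness is `LatticeChain.refutes_eq_false`. It is
transferred to curves in `NormalizedCurve.false`, and `exists_dilation_le_of_copies` brings the
chain at the junction into the normal form that this requires.
-/

/-! ### Poses of a unit square -/

/-- A symmetry of a square: the coordinates are exchanged if `swap` holds, then each of them is
reflected if the corresponding flag holds. -/
structure Pose where
  swap : Bool
  flipX : Bool
  flipY : Bool

namespace Pose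

/-- First coordinate of the image of `(x, y)` under a symmetry of the square `[0, one]²`. -/
def fst {R : Type} [Sub R] (p : Pose) (one x y : R) : R :=
  bif p.flipX then one - (bif p.swap then y else x) else bif p.swap then y else x

/-- Second coordinate of the image of `(x, y)` under a symmetry of the square `[0, one]²`. -/
def snd {R : Type} [Sub R] (p : Pose) (one x y : R) : R :=
  bif p.flipY then one - (bif p.swap then x else y) else bif p.swap then x else y

/-- The identity pose. -/
def one : Pose := ⟨false, false, false⟩

/-- The eight symmetries of a square. -/
def list : List Pose :=
  [⟨false, false, false⟩, ⟨false, false, true⟩, ⟨false, true, false⟩, ⟨false, true, true⟩,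
    ⟨true, false, false⟩, ⟨true, false, true⟩, ⟨true, true, false⟩, ⟨true, true, true⟩]

theorem mem_list (p : Pose) : p ∈ list := by
  rcases p with ⟨_ | _, _ | _, _ | _⟩ <;> simp [list]

end Pose

/-! ### Integer bounds on two unknown times -/

/-- The part of a visiting time that depends on the two unknown times `x` and `y`. -/
inductive Phase
  | const | x | negX | y | negY

namespace Phase

/-- The real value of a phase. -/
def val (x y : ℝ) : Phase → ℝ
  | const => 0
  | .x => x
  | negX => -x
  | .y => y
  | negY => -y

/-- The opposite phase. -/
def neg : Phase → Phase
  | const => const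
  | .x => negX
  | negX => .x
  | .y => negY
  | negY => .y

theorem val_neg (x y : ℝ) (f : Phase) : f.neg.val x y = -f.val x y := by
  cases f <;> simp [neg, val]

end Phase

/-- Strict upper bounds, each shifted by `2000`, for `2x`, `-2x`, `2y`, `-2y`, `x + y`, `-x - y`,
`x - y`, `y - x` and `0`, in this order. -/
structure Bounds where
  a0 : ℕ
  a1 : ℕ
  a2 : ℕ
  a3 : ℕ
  a4 : ℕ
  a5 : ℕ
  a6 : ℕ
  a7 : ℕ
  a8 : ℕ

/-- Pass `n` to `k` in evaluated form. Without it, the kernel would carry growing unevaluated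
arithmetic terms through the search below. This definition, as well as those that follow, is written
with recursors because the kernel unfolds these with the least overhead. -/
noncomputable def force {α : Type} (n : ℕ) (k : ℕ → α) : α :=
  Nat.rec (motive := fun _ => α) (k 0) (fun m _ => k m) (Nat.succ n)

@[simp] theorem force_eq {α : Type} (n : ℕ) (k : ℕ → α) : force n k = k n := rfl

theorem bool_rec_eq_bif {α : Type} (c : Bool) (e t : α) :
    Bool.rec (motive := fun _ => α) e t c = bif c then t else e := by
  cases c <;> rfl

namespace Bounds

/-- The pair `(x, y)` respects all bounds. -/
structure Holds (b : Bounds) (x y : ℝ) : Prop where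
  h0 : 2 * x < b.a0 - 2000
  h1 : -(2 * x) < b.a1 - 2000
  h2 : 2 * y < b.a2 - 2000
  h3 : -(2 * y) < b.a3 - 2000
  h4 : x + y < b.a4 - 2000
  h5 : -x - y < b.a5 - 2000
  h6 : x - y < b.a6 - 2000
  h7 : y - x < b.a7 - 2000
  h8 : (0 : ℝ) < b.a8 - 2000

/-- Some positive combination of at most three bounds is contradictory. By Helly's theorem in the
plane this detects every infeasible system of bounds. -/
def dead : Bounds → Bool
  | ⟨a0, a1, a2, a3, a4, a5, a6, a7, a8⟩ =>
    Nat.ble a8 2000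
    || Nat.ble (Nat.add a0 a1) 4000 || Nat.ble (Nat.add a2 a3) 4000
    || Nat.ble (Nat.add a4 a5) 4000 || Nat.ble (Nat.add a6 a7) 4000
    || Nat.ble (Nat.add (Nat.add a4 a4) (Nat.add a1 a3)) 8000
    || Nat.ble (Nat.add (Nat.add a5 a5) (Nat.add a0 a2)) 8000
    || Nat.ble (Nat.add (Nat.add a6 a6) (Nat.add a1 a2)) 8000
    || Nat.ble (Nat.add (Nat.add a7 a7) (Nat.add a0 a3)) 8000
    || Nat.ble (Nat.add (Nat.add a4 a6) a1) 6000 || Nat.ble (Nat.add (Nat.add a4 a7) a3) 6000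
    || Nat.ble (Nat.add (Nat.add a5 a7) a0) 6000 || Nat.ble (Nat.add (Nat.add a5 a6) a2) 6000

theorem Holds.not_dead {b : Bounds} {x y : ℝ} (h : b.Holds x y) : b.dead = false := by
  rcases b with ⟨a0, a1, a2, a3, a4, a5, a6, a7, a8⟩
  obtain ⟨h0, h1, h2, h3, h4, h5, h6, h7, h8⟩ := h
  simp only [] at h0 h1 h2 h3 h4 h5 h6 h7 h8
  simp only [dead, Bool.or_eq_false_iff, Nat.add_eq]
  have key : ∀ m n : ℕ, (n : ℝ) < m → Nat.ble m n = false := by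
    intro m n hmn
    rw [← Bool.not_eq_true, Nat.ble_eq]
    exact not_le.mpr (by exact_mod_cast hmn)
  refine ⟨⟨⟨⟨⟨⟨⟨⟨⟨⟨⟨⟨?_, ?_⟩, ?_⟩, ?_⟩, ?_⟩, ?_⟩, ?_⟩, ?_⟩, ?_⟩, ?_⟩, ?_⟩, ?_⟩, ?_⟩ <;>
    (apply key; push_cast; linarith)

/-- `set0`, …, `set8` replace the bound `a0`, …, `a8` by `e` if this is smaller. -/
noncomputable def set0 (b : Bounds) (e : ℕ) : Bounds :=
  Bounds.rec (motive := fun _ => Bounds) (fun a0 a1 a2 a3 a4 a5 a6 a7 a8 =>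
    Bool.rec (motive := fun _ => Bounds) (force e fun c => ⟨c, a1, a2, a3, a4, a5, a6, a7, a8⟩)
      b (Nat.ble a0 e)) b

noncomputable def set1 (b : Bounds) (e : ℕ) : Bounds :=
  Bounds.rec (motive := fun _ => Bounds) (fun a0 a1 a2 a3 a4 a5 a6 a7 a8 =>
    Bool.rec (motive := fun _ => Bounds) (force e fun c => ⟨a0, c, a2, a3, a4, a5, a6, a7, a8⟩)
      b (Nat.ble a1 e)) b

noncomputable def set2 (b : Bounds) (e : ℕ) : Bounds :=
  Bounds.rec (motive := fun _ => Bounds) (fun a0 a1 a2 a3 a4 a5 a6 a7 a8 =>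
    Bool.rec (motive := fun _ => Bounds) (force e fun c => ⟨a0, a1, c, a3, a4, a5, a6, a7, a8⟩)
      b (Nat.ble a2 e)) b

noncomputable def set3 (b : Bounds) (e : ℕ) : Bounds :=
  Bounds.rec (motive := fun _ => Bounds) (fun a0 a1 a2 a3 a4 a5 a6 a7 a8 =>
    Bool.rec (motive := fun _ => Bounds) (force e fun c => ⟨a0, a1, a2, c, a4, a5, a6, a7, a8⟩)
      b (Nat.ble a3 e)) b

noncomputable def set4 (b : Bounds) (e : ℕ) : Bounds :=
  Bounds.rec (motive := fun _ => Bounds) (fun a0 a1 a2 a3 a4 a5 a6 a7 a8 =>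
    Bool.rec (motive := fun _ => Bounds) (force e fun c => ⟨a0, a1, a2, a3, c, a5, a6, a7, a8⟩)
      b (Nat.ble a4 e)) b

noncomputable def set5 (b : Bounds) (e : ℕ) : Bounds :=
  Bounds.rec (motive := fun _ => Bounds) (fun a0 a1 a2 a3 a4 a5 a6 a7 a8 =>
    Bool.rec (motive := fun _ => Bounds) (force e fun c => ⟨a0, a1, a2, a3, a4, c, a6, a7, a8⟩)
      b (Nat.ble a5 e)) b

noncomputable def set6 (b : Bounds) (e : ℕ) : Bounds :=
  Bounds.rec (motive := fun _ => Bounds) (fun a0 a1 a2 a3 a4 a5 a6 a7 a8 =>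
    Bool.rec (motive := fun _ => Bounds) (force e fun c => ⟨a0, a1, a2, a3, a4, a5, c, a7, a8⟩)
      b (Nat.ble a6 e)) b

noncomputable def set7 (b : Bounds) (e : ℕ) : Bounds :=
  Bounds.rec (motive := fun _ => Bounds) (fun a0 a1 a2 a3 a4 a5 a6 a7 a8 =>
    Bool.rec (motive := fun _ => Bounds) (force e fun c => ⟨a0, a1, a2, a3, a4, a5, a6, c, a8⟩)
      b (Nat.ble a7 e)) b

noncomputable def set8 (b : Bounds) (e : ℕ) : Bounds :=
  Bounds.rec (motive := fun _ => Bounds) (fun a0 a1 a2 a3 a4 a5 a6 a7 a8 =>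
    Bool.rec (motive := fun _ => Bounds) (force e fun c => ⟨a0, a1, a2, a3, a4, a5, a6, a7, c⟩)
      b (Nat.ble a8 e)) b

/-- Record the inequality `f - f' < c - 2000` between two phases. If one of them is constant, the
inequality is doubled first, because the bounds for a single unknown are bounds for its double. -/
noncomputable def upd (b : Bounds) (f f' : Phase) (c : ℕ) : Bounds :=
  Phase.rec (motive := fun _ => Bounds)
    (Phase.rec (motive := fun _ => Bounds)
      (b.set8 c)
      (b.set1 (Nat.sub (Nat.add c c) 2000))
      (b.set0 (Nat.sub (Nat.add c c) 2000))
      (b.set3 (Nat.sub (Nat.add c c) 2000))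
      (b.set2 (Nat.sub (Nat.add c c) 2000)) f')
    (Phase.rec (motive := fun _ => Bounds)
      (b.set0 (Nat.sub (Nat.add c c) 2000))
      (b.set8 c)
      (b.set0 c)
      (b.set6 c)
      (b.set4 c) f')
    (Phase.rec (motive := fun _ => Bounds)
      (b.set1 (Nat.sub (Nat.add c c) 2000))
      (b.set1 c)
      (b.set8 c)
      (b.set5 c)
      (b.set7 c) f')
    (Phase.rec (motive := fun _ => Bounds)
      (b.set2 (Nat.sub (Nat.add c c) 2000))
      (b.set7 c)
      (b.set4 c)
      (b.set8 c)
      (b.set2 c) f')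
    (Phase.rec (motive := fun _ => Bounds)
      (b.set3 (Nat.sub (Nat.add c c) 2000))
      (b.set5 c)
      (b.set6 c)
      (b.set3 c)
      (b.set8 c) f')
    f

theorem Holds.upd {b : Bounds} {x y : ℝ} (h : b.Holds x y) {f f' : Phase} {c : ℕ}
    (hc : f.val x y - f'.val x y < c - 2000) : (b.upd f f' c).Holds x y := by
  have hcc : (2 * c : ℝ) - 2000 ≤ ((c + c - 2000 : ℕ) : ℝ) := by
    have : c + c ≤ (c + c - 2000) + 2000 := by omega
    have : ((c + c : ℕ) : ℝ) ≤ (((c + c - 2000) + 2000 : ℕ) : ℝ) := by exact_mod_cast this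
    push_cast at this ⊢
    linarith
  have h' := h
  obtain ⟨h0, h1, h2, h3, h4, h5, h6, h7, h8⟩ := h'
  have key0 : ∀ e : ℕ, 2 * x < e - 2000 → (b.set0 e).Holds x y := by
    intro e he
    rcases b with ⟨a0, a1, a2, a3, a4, a5, a6, a7, a8⟩
    simp only [set0, bool_rec_eq_bif, force_eq]
    cases hb : Nat.ble a0 e
    · exact ⟨he, h1, h2, h3, h4, h5, h6, h7, h8⟩
    · exact h
  have key1 : ∀ e : ℕ, -(2 * x) < e - 2000 → (b.set1 e).Holds x y := by
    intro e he
    rcases b with ⟨a0, a1, a2, a3, a4, a5, a6, a7, a8⟩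
    simp only [set1, bool_rec_eq_bif, force_eq]
    cases hb : Nat.ble a1 e
    · exact ⟨h0, he, h2, h3, h4, h5, h6, h7, h8⟩
    · exact h
  have key2 : ∀ e : ℕ, 2 * y < e - 2000 → (b.set2 e).Holds x y := by
    intro e he
    rcases b with ⟨a0, a1, a2, a3, a4, a5, a6, a7, a8⟩
    simp only [set2, bool_rec_eq_bif, force_eq]
    cases hb : Nat.ble a2 e
    · exact ⟨h0, h1, he, h3, h4, h5, h6, h7, h8⟩
    · exact h
  have key3 : ∀ e : ℕ, -(2 * y) < e - 2000 → (b.set3 e).Holds x y := by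
    intro e he
    rcases b with ⟨a0, a1, a2, a3, a4, a5, a6, a7, a8⟩
    simp only [set3, bool_rec_eq_bif, force_eq]
    cases hb : Nat.ble a3 e
    · exact ⟨h0, h1, h2, he, h4, h5, h6, h7, h8⟩
    · exact h
  have key4 : ∀ e : ℕ, x + y < e - 2000 → (b.set4 e).Holds x y := by
    intro e he
    rcases b with ⟨a0, a1, a2, a3, a4, a5, a6, a7, a8⟩
    simp only [set4, bool_rec_eq_bif, force_eq]
    cases hb : Nat.ble a4 e
    · exact ⟨h0, h1, h2, h3, he, h5, h6, h7, h8⟩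
    · exact h
  have key5 : ∀ e : ℕ, -x - y < e - 2000 → (b.set5 e).Holds x y := by
    intro e he
    rcases b with ⟨a0, a1, a2, a3, a4, a5, a6, a7, a8⟩
    simp only [set5, bool_rec_eq_bif, force_eq]
    cases hb : Nat.ble a5 e
    · exact ⟨h0, h1, h2, h3, h4, he, h6, h7, h8⟩
    · exact h
  have key6 : ∀ e : ℕ, x - y < e - 2000 → (b.set6 e).Holds x y := by
    intro e he
    rcases b with ⟨a0, a1, a2, a3, a4, a5, a6, a7, a8⟩
    simp only [set6, bool_rec_eq_bif, force_eq]
    cases hb : Nat.ble a6 e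
    · exact ⟨h0, h1, h2, h3, h4, h5, he, h7, h8⟩
    · exact h
  have key7 : ∀ e : ℕ, y - x < e - 2000 → (b.set7 e).Holds x y := by
    intro e he
    rcases b with ⟨a0, a1, a2, a3, a4, a5, a6, a7, a8⟩
    simp only [set7, bool_rec_eq_bif, force_eq]
    cases hb : Nat.ble a7 e
    · exact ⟨h0, h1, h2, h3, h4, h5, h6, he, h8⟩
    · exact h
  have key8 : ∀ e : ℕ, (0 : ℝ) < e - 2000 → (b.set8 e).Holds x y := by
    intro e he
    rcases b with ⟨a0, a1, a2, a3, a4, a5, a6, a7, a8⟩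
    simp only [set8, bool_rec_eq_bif, force_eq]
    cases hb : Nat.ble a8 e
    · exact ⟨h0, h1, h2, h3, h4, h5, h6, h7, he⟩
    · exact h
  have hD : ((Nat.sub (Nat.add c c) 2000 : ℕ) : ℝ) = ((c + c - 2000 : ℕ) : ℝ) := rfl
  cases f <;> cases f' <;> simp only [Phase.val] at hc
  · exact key8 c (by linarith)
  · exact key1 (Nat.sub (Nat.add c c) 2000) (by linarith)
  · exact key0 (Nat.sub (Nat.add c c) 2000) (by linarith)
  · exact key3 (Nat.sub (Nat.add c c) 2000) (by linarith)
  · exact key2 (Nat.sub (Nat.add c c) 2000) (by linarith)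
  · exact key0 (Nat.sub (Nat.add c c) 2000) (by linarith)
  · exact key8 c (by linarith)
  · exact key0 c (by linarith)
  · exact key6 c (by linarith)
  · exact key4 c (by linarith)
  · exact key1 (Nat.sub (Nat.add c c) 2000) (by linarith)
  · exact key1 c (by linarith)
  · exact key8 c (by linarith)
  · exact key5 c (by linarith)
  · exact key7 c (by linarith)
  · exact key2 (Nat.sub (Nat.add c c) 2000) (by linarith)
  · exact key7 c (by linarith)
  · exact key4 c (by linarith)
  · exact key8 c (by linarith)
  · exact key2 c (by linarith)
  · exact key3 (Nat.sub (Nat.add c c) 2000) (by linarith)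
  · exact key5 c (by linarith)
  · exact key6 c (by linarith)
  · exact key3 c (by linarith)
  · exact key8 c (by linarith)

end Bounds

/-! ### Visits of lattice points -/

/-- The curve visits the lattice point `(X, Y)` at the time `K + phase`. -/
structure Visit where
  X : ℕ
  Y : ℕ
  K : ℕ
  phase : Phase

namespace Visit

/-- The time of a visit. -/
def time (x y : ℝ) (v : Visit) : ℝ := v.K + v.phase.val x y

/-- The visit `v` precedes `w`, and the square of their distance is less than `17/3` times the time
between them, where the unit of time is `1/17`. Nothing is said about visits of the same point. -/
def Sep (x y : ℝ) (v w : Visit) : Prop :=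
  ¬ (v.X = w.X ∧ v.Y = w.Y) →
    v.time x y + 3 * (((v.X : ℝ) - w.X) ^ 2 + ((v.Y : ℝ) - w.Y) ^ 2) < w.time x y

end Visit

/-- Add to the bounds the inequality between the visits `v` and `w`. In the recursion on the square of
their distance the successor case is `d + 1`, and `1997` is `2000 - 3`. -/
noncomputable def Bounds.addPair (b : Bounds) (v w : Visit) : Bounds :=
  Visit.rec (motive := fun _ => Bounds) (fun X Y K f =>
    Visit.rec (motive := fun _ => Bounds) (fun X' Y' K' f' =>
      Nat.rec (motive := fun _ => Bounds) b
        (fun d _ => b.upd f f' (Nat.sub (Nat.add K' 1997) (Nat.add K (Nat.mul 3 d))))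
        (Nat.sub (Nat.add (Nat.add (Nat.mul X X) (Nat.mul X' X'))
            (Nat.add (Nat.mul Y Y) (Nat.mul Y' Y')))
          (Nat.mul 2 (Nat.add (Nat.mul X X') (Nat.mul Y Y'))))) w) v

theorem Bounds.Holds.addPair {b : Bounds} {x y : ℝ} (h : b.Holds x y) {v w : Visit}
    (hs : v.Sep x y w) : (b.addPair v w).Holds x y := by
  rcases v with ⟨X, Y, K, f⟩
  rcases w with ⟨X', Y', K', f'⟩
  simp only [Bounds.addPair, Nat.sub_eq, Nat.add_eq, Nat.mul_eq]
  generalize hd : X * X + X' * X' + (Y * Y + Y' * Y') - 2 * (X * X' + Y * Y') = d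
  have hle : 2 * (X * X' + Y * Y') ≤ X * X + X' * X' + (Y * Y + Y' * Y') := by
    zify
    nlinarith [sq_nonneg ((X : ℤ) - X'), sq_nonneg ((Y : ℤ) - Y')]
  have hdR : (d : ℝ) = ((X : ℝ) - X') ^ 2 + ((Y : ℝ) - Y') ^ 2 := by
    rw [← hd, Nat.cast_sub hle]
    push_cast
    ring
  cases d with
  | zero => exact h
  | succ d =>
    refine h.upd ?_
    have hne : ¬ (X = X' ∧ Y = Y') := by
      rintro ⟨rfl, rfl⟩
      have : ((d + 1 : ℕ) : ℝ) = 0 := by rw [hdR]; ring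
      exact absurd this (by positivity)
    have hlt := hs hne
    simp only [Visit.time] at hlt
    rw [← hdR] at hlt
    have : K' + 1997 ≤ (K' + 1997 - (K + 3 * d)) + (K + 3 * d) := by omega
    have : ((K' + 1997 : ℕ) : ℝ) ≤ (((K' + 1997 - (K + 3 * d)) + (K + 3 * d) : ℕ) : ℝ) := by
      exact_mod_cast this
    push_cast at this hlt ⊢
    linarith

/-- Compare the visit `v` with all visits of the list `l`, which are earlier if `fw` holds, and later
otherwise. -/
noncomputable def Bounds.addVisit (fw : Bool) (v : Visit) (l : List Visit) : Bounds → Bounds :=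
  List.rec (motive := fun _ => Bounds → Bounds) (fun b => b)
    (fun w _ ih b => Bounds.rec (motive := fun _ => Bounds)
      (fun a0 a1 a2 a3 a4 a5 a6 a7 a8 => ih ⟨a0, a1, a2, a3, a4, a5, a6, a7, a8⟩)
      (Bool.rec (motive := fun _ => Bounds) (b.addPair v w) (b.addPair w v) fw)) l

theorem Bounds.Holds.addVisit {x y : ℝ} {fw : Bool} {v : Visit} :
    ∀ {l : List Visit} {b : Bounds}, b.Holds x y →
      (∀ w ∈ l, bif fw then w.Sep x y v else v.Sep x y w) → (b.addVisit fw v l).Holds x y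
  | [], _, h, _ => h
  | w :: l, b, h, hl => by
    have hw := hl w (by simp)
    have hl' : ∀ w ∈ l, bif fw then w.Sep x y v else v.Sep x y w :=
      fun w' hw' => hl w' (by simp [hw'])
    cases fw
    · exact (h.addPair hw).addVisit hl'
    · exact (h.addPair hw).addVisit hl'

/-- Compare all visits of the list `l` with all visits of the list `l'`. -/
noncomputable def Bounds.addVisits (fw : Bool) (l l' : List Visit) : Bounds → Bounds :=
  List.rec (motive := fun _ => Bounds → Bounds) (fun b => b)
    (fun v _ ih b => Bounds.rec (motive := fun _ => Bounds)
      (fun a0 a1 a2 a3 a4 a5 a6 a7 a8 => ih ⟨a0, a1, a2, a3, a4, a5, a6, a7, a8⟩)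
      (b.addVisit fw v l)) l'

theorem Bounds.Holds.addVisits {x y : ℝ} {fw : Bool} {l : List Visit} :
    ∀ {l' : List Visit} {b : Bounds}, b.Holds x y →
      (∀ v ∈ l', ∀ w ∈ l, bif fw then w.Sep x y v else v.Sep x y w) →
      (b.addVisits fw l l').Holds x y
  | [], _, h, _ => h
  | v :: _, _, h, hl => (h.addVisit (hl v (by simp))).addVisits fun v' hv' => hl v' (by simp [hv'])

/-- The bounds that arise from the visits of a list in the order of time. At first nothing is known
but that `x` and `y` lie between `0` and `17`. -/
noncomputable def Bounds.ofVisits (l : List Visit) : Bounds :=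
  List.rec (motive := fun _ => Bounds)
    ⟨2035, 2001, 2035, 2001, 2035, 2001, 2018, 2018, 2001⟩
    (fun v l ih => ih.addVisit false v l) l

theorem Bounds.holds_ofVisits {x y : ℝ} (hx : x ∈ Icc (0 : ℝ) 17) (hy : y ∈ Icc (0 : ℝ) 17) :
    ∀ {l : List Visit}, l.Pairwise (Visit.Sep x y) → (Bounds.ofVisits l).Holds x y
  | [], _ => by
    obtain ⟨hx0, hx1⟩ := hx
    obtain ⟨hy0, hy1⟩ := hy
    constructor <;> simp only [Bounds.ofVisits] <;> push_cast <;> linarith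
  | v :: l, h => by
    rw [List.pairwise_cons] at h
    exact (Bounds.holds_ofVisits hx hy h.2).addVisit (fw := false) h.1

/-! ### Exhaustive search over chains of squares -/

/-- What is known about the base curve, which runs from the vertex `(0, 0)` through the square
`[0, 1]²` in 17 units of time. A coordinate of its end point is encoded by `0`, `2` or `1`, according
as it is `0`, `1` or strictly between. The stops are visits of vertices in the order of time. -/
structure Itinerary where
  exitX : ℕ
  exitY : ℕ
  stops : List Visit

/-- A copy of the base curve in the lattice square with lower left corner `(zx, zy)`, with its
number in the order of time and its visits of vertices. -/
structure Tile where
  zx : ℕ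
  zy : ℕ
  num : ℕ
  visits : List Visit

/-- The visit of the `i`-th copy of the base curve that corresponds to the visit `v` of the base
curve; `r` tells whether the copy is traversed backwards. -/
def Visit.copy (p : Pose) (zx zy i : ℕ) (r : Bool) (v : Visit) : Visit :=
  ⟨zx + p.fst 1 v.X v.Y, zy + p.snd 1 v.X v.Y, 17 * i + (bif r then 17 - v.K else v.K),
    bif r then v.phase.neg else v.phase⟩

/-- The lattice square `(zx, zy)` is occupied by one of the tiles. -/
noncomputable def occupied (zx zy : ℕ) (l : List Tile) : Bool :=
  List.rec (motive := fun _ => Bool) false (fun t _ ih =>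
    Tile.rec (motive := fun _ => Bool) (fun zx' zy' _ _ =>
      Bool.rec (motive := fun _ => Bool) ih
        (Bool.rec (motive := fun _ => Bool) ih true (Nat.beq zy' zy)) (Nat.beq zx' zx)) t) l

/-- The tile is so close to the square `(zx, zy)` in space, and so far from it in time, that a
comparison of their visits would hardly improve the bounds. To skip it is always sound. -/
noncomputable def harmless (zx zy i : ℕ) (t : Tile) : Bool :=
  Tile.rec (motive := fun _ => Bool) (fun zx' zy' i' _ =>
    force (Nat.succ (Nat.add (Nat.sub zx zx') (Nat.sub zx' zx))) fun dx =>
    force (Nat.succ (Nat.add (Nat.sub zy zy') (Nat.sub zy' zy))) fun dy =>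
    Nat.ble (Nat.add (Nat.mul 3 (Nat.add (Nat.mul dx dx) (Nat.mul dy dy))) 5)
      (Nat.mul 17 (Nat.add (Nat.sub i i') (Nat.sub i' i)))) t

/-- Compare the visits `vs` of a new tile with those of all tiles of a list. The result is `true` if
the bounds become contradictory, and otherwise it is the value of `k` at the bounds obtained. -/
noncomputable def compareTiles (fw : Bool) (zx zy i : ℕ) (vs : List Visit) (k : Bounds → Bool)
    (l : List Tile) : Bounds → Bool :=
  List.rec (motive := fun _ => Bounds → Bool) k (fun t _ ih b =>
    Bool.rec (motive := fun _ => Bool)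
      (Bounds.rec (motive := fun _ => Bool) (fun a0 a1 a2 a3 a4 a5 a6 a7 a8 =>
          Bool.rec (motive := fun _ => Bool) (ih ⟨a0, a1, a2, a3, a4, a5, a6, a7, a8⟩) true
            (Bounds.dead ⟨a0, a1, a2, a3, a4, a5, a6, a7, a8⟩))
        (b.addVisits fw t.visits vs))
      (ih b) (harmless zx zy i t)) l

theorem exists_holds_of_compareTiles {x y : ℝ} {fw : Bool} {zx zy i : ℕ} {vs : List Visit}
    {k : Bounds → Bool} :
    ∀ {l : List Tile} {b : Bounds}, b.Holds x y →
      (∀ t ∈ l, ∀ v ∈ vs, ∀ w ∈ t.visits, bif fw then w.Sep x y v else v.Sep x y w) →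
      compareTiles fw zx zy i vs k l b = true → ∃ b' : Bounds, b'.Holds x y ∧ k b' = true
  | [], b, h, _, hk => ⟨b, h, hk⟩
  | t :: l, b, h, hl, hk => by
    have hl' : ∀ t ∈ l, ∀ v ∈ vs, ∀ w ∈ t.visits, bif fw then w.Sep x y v else v.Sep x y w :=
      fun t' ht' => hl t' (by simp [ht'])
    change Bool.rec (motive := fun _ => Bool)
      (Bool.rec (motive := fun _ => Bool) (compareTiles fw zx zy i vs k l
        (b.addVisits fw t.visits vs)) true (b.addVisits fw t.visits vs).dead)
      (compareTiles fw zx zy i vs k l b) (harmless zx zy i t) = true at hk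
    rw [bool_rec_eq_bif] at hk
    cases hh : harmless zx zy i t
    · rw [hh, cond_false] at hk
      have h' : (b.addVisits fw t.visits vs).Holds x y := h.addVisits (hl t (by simp))
      rw [h'.not_dead] at hk
      exact exists_holds_of_compareTiles h' hl' hk
    · rw [hh, cond_true] at hk
      exact exists_holds_of_compareTiles h hl' hk

/-- All choices of a pose and of a direction satisfy `P`. -/
noncomputable def allPoses (P : Pose → Bool → Bool) : Bool :=
  List.rec (motive := fun _ => Bool) true (fun p _ ih =>
    Bool.rec (motive := fun _ => Bool) false
      (Bool.rec (motive := fun _ => Bool) false ih (P p true)) (P p false)) Pose.list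

theorem of_allPoses {P : Pose → Bool → Bool} (h : allPoses P = true) (p : Pose) (r : Bool) :
    P p r = true := by
  have key : ∀ l : List Pose, List.rec (motive := fun _ => Bool) true (fun p _ ih =>
      Bool.rec (motive := fun _ => Bool) false
      (Bool.rec (motive := fun _ => Bool) false ih (P p true)) (P p false)) l = true →
      ∀ p ∈ l, P p r = true := by
    intro l
    induction l with
    | nil => simp
    | cons q l ih =>
      intro hq
      simp only [bool_rec_eq_bif] at hq ih
      cases h1 : P q false
      · rw [h1] at hq
        exact absurd hq (by simp)
      · cases h2 : P q true
        · rw [h1, h2] at hq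
          exact absurd hq (by simp)
        · rw [h1, h2] at hq
          intro p hp
          rcases List.mem_cons.mp hp with rfl | hp
          · cases r <;> assumption
          · exact ih hq p hp
  exact key _ h p (Pose.mem_list p)

/-- One step of the search: try all ways to prolong a chain of tiles, at its end if `fw` holds and
at its beginning otherwise, and go on with `next` unless the bounds become contradictory. Here
`(fx, fy)` is the code (twice the coordinate if this is an integer) of the point at which the new
tile is attached, and `i` is the number of the new tile. Tiles with number at least 16 lie in the
quadrant with corner `(16, 16)`, and the other tiles in the opposite quadrant. A placement for which
the corner of the new tile would not be a lattice point is impossible. -/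
noncomputable def prolong (T : Itinerary) (fw : Bool) (fx fy i : ℕ)
    (next : ℕ → ℕ → List Tile → Bounds → Bool) (tiles : List Tile) (b : Bounds) : Bool :=
  allPoses fun p r =>
    force (Nat.sub fx (bif r != fw then p.fst 2 0 0 else p.fst 2 T.exitX T.exitY)) fun dx =>
    force (Nat.sub fy (bif r != fw then p.snd 2 0 0 else p.snd 2 T.exitX T.exitY)) fun dy =>
    Bool.rec (motive := fun _ => Bool)
      (force (Nat.div dx 2) fun zx => force (Nat.div dy 2) fun zy =>
      Bool.rec (motive := fun _ => Bool)
        (force (Nat.add dx (bif r != fw then p.fst 2 T.exitX T.exitY else p.fst 2 0 0)) fun ox =>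
        force (Nat.add dy (bif r != fw then p.snd 2 T.exitX T.exitY else p.snd 2 0 0)) fun oy =>
        compareTiles fw zx zy i (T.stops.map (Visit.copy p zx zy i r))
          (next ox oy (⟨zx, zy, i, T.stops.map (Visit.copy p zx zy i r)⟩ :: tiles)) tiles b)
        true
        ((bif fw then Nat.ble zx 15 || Nat.ble zy 15 else Nat.ble 16 zx || Nat.ble 16 zy)
          || occupied zx zy tiles))
      true (Nat.beq (Nat.mod dx 2) 1 || Nat.beq (Nat.mod dy 2) 1)

/-- Try all ways to prolong a chain of tiles, and show that the bounds become contradictory. The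
schedule tells for each step whether the chain is prolonged at its end or at its beginning. Here
`(fx, fy)` and `(gx, gy)` are the codes of the last and of the first point of the chain, and `hi` and
`lo` are the numbers of the next tiles. -/
noncomputable def explore (T : Itinerary) (sched : List Bool) :
    ℕ → ℕ → ℕ → ℕ → ℕ → ℕ → List Tile → Bounds → Bool :=
  List.rec (motive := fun _ => ℕ → ℕ → ℕ → ℕ → ℕ → ℕ → List Tile → Bounds → Bool)
    (fun _ _ _ _ _ _ _ _ => false)
    (fun fw _ ih fx fy hi gx gy lo tiles b =>
      Bool.rec (motive := fun _ => Bool)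
        (prolong T false gx gy lo (fun ox oy => force (Nat.pred lo) (ih fx fy hi ox oy)) tiles b)
        (prolong T true fx fy hi (fun ox oy => force (Nat.succ hi) fun hi' =>
          ih ox oy hi' gx gy lo) tiles b) fw) sched

/-- The search that begins with the single tile number 16 in the square with corner `(16, 16)`. -/
noncomputable def refutes (T : Itinerary) (sched : List Bool) : Bool :=
  Bounds.rec (motive := fun _ => Bool) (fun a0 a1 a2 a3 a4 a5 a6 a7 a8 =>
    explore T sched (Nat.add 32 T.exitX) (Nat.add 32 T.exitY) 17 32 32 15
      [⟨16, 16, 16, T.stops.map (Visit.copy Pose.one 16 16 16 false)⟩]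
      ⟨a0, a1, a2, a3, a4, a5, a6, a7, a8⟩) (Bounds.ofVisits T.stops)

/-! ### The itineraries -/

/-- The start of the base curve at the vertex `(0, 0)`. -/
def Visit.start : Visit := ⟨0, 0, 0, .const⟩

/-- The base curve visits the vertices `(X₁, Y₁)` and `(X₂, Y₂)` at unknown times, and ends at the
vertex `(X, Y)`. -/
def Itinerary.ofVertices (X₁ Y₁ X₂ Y₂ X Y : ℕ) : Itinerary :=
  ⟨2 * X, 2 * Y, [Visit.start, ⟨X₁, Y₁, 0, .x⟩, ⟨X₂, Y₂, 0, .y⟩, ⟨X, Y, 17, .const⟩]⟩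

/-- The base curve visits the vertices `(X₁, Y₁)` and `(X₂, Y₂)` at unknown times, and ends at a
point with the code `(eX, eY)`. -/
def Itinerary.ofCode (X₁ Y₁ X₂ Y₂ eX eY : ℕ) : Itinerary :=
  ⟨eX, eY, [Visit.start, ⟨X₁, Y₁, 0, .x⟩, ⟨X₂, Y₂, 0, .y⟩]⟩

/-- An order of steps that keeps the search small for a base curve that joins opposite vertices. -/
def diagonalSchedule : List Bool :=
  [false, true, true, true, true, false, false, false, true, true, true, false, true]

/-- An order of steps that keeps the search small for a base curve that joins adjacent vertices. -/
def sideSchedule : List Bool :=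
  [true, false, true, false, false, false, false, false, true, true, true, true, false]

/-- An order of steps that keeps the search small for the other base curves. -/
def generalSchedule : List Bool :=
  [true, false, false, true, false, false, false, true, true, true, false, true, false]

set_option maxHeartbeats 0 in
theorem refutes_diagonal :
    refutes (.ofVertices 1 0 0 1 1 1) diagonalSchedule = true := by decide +kernel

set_option maxHeartbeats 0 in
theorem refutes_side : refutes (.ofVertices 0 1 1 1 1 0) sideSchedule = true := by decide +kernel

set_option maxHeartbeats 0 in
theorem refutes_side' : refutes (.ofVertices 1 1 0 1 1 0) sideSchedule = true := by decide +kernel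

set_option maxHeartbeats 0 in
theorem refutes_general :
    ∀ e ∈ [(0, 0), (0, 1), (1, 0), (1, 1), (1, 2), (2, 1)],
      refutes (.ofCode 1 0 0 1 e.1 e.2) generalSchedule = true := by decide +kernel

/-! ### Soundness of the search -/

/-- A chain of 32 consecutive copies of the base curve in distinct lattice squares, the copies with
number at least 16 lying in the quadrant with corner `(16, 16)` and the others in the opposite
quadrant. The separation of visits expresses the assumed upper bound for the dilation. -/
structure LatticeChain (T : Itinerary) (x y : ℝ) where
  pose : ℕ → Pose
  zx : ℕ → ℕ
  zy : ℕ → ℕ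
  rev : ℕ → Bool
  pose_base : pose 16 = Pose.one
  zx_base : zx 16 = 16
  zy_base : zy 16 = 16
  rev_base : rev 16 = false
  quadrant_right : ∀ i, 16 ≤ i → i < 32 → 16 ≤ zx i ∧ 16 ≤ zy i
  quadrant_left : ∀ i < 16, zx i < 16 ∧ zy i < 16
  injective : ∀ i j, i < j → j < 32 → ¬ (zx i = zx j ∧ zy i = zy j)
  junctionX : ∀ i, i + 1 < 32 →
    2 * zx i + (bif rev i then (pose i).fst 2 0 0 else (pose i).fst 2 T.exitX T.exitY) =
    2 * zx (i + 1) + (bif rev (i + 1) then (pose (i + 1)).fst 2 T.exitX T.exitY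
      else (pose (i + 1)).fst 2 0 0)
  junctionY : ∀ i, i + 1 < 32 →
    2 * zy i + (bif rev i then (pose i).snd 2 0 0 else (pose i).snd 2 T.exitX T.exitY) =
    2 * zy (i + 1) + (bif rev (i + 1) then (pose (i + 1)).snd 2 T.exitX T.exitY
      else (pose (i + 1)).snd 2 0 0)
  mem_x : x ∈ Icc (0 : ℝ) 17
  mem_y : y ∈ Icc (0 : ℝ) 17
  pairwise : T.stops.Pairwise (Visit.Sep x y)
  sep : ∀ i j, i < j → j < 32 → ∀ v ∈ T.stops, ∀ w ∈ T.stops,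
    Visit.Sep x y (v.copy (pose i) (zx i) (zy i) i (rev i))
      (w.copy (pose j) (zx j) (zy j) j (rev j))

namespace LatticeChain

variable {T : Itinerary} {x y : ℝ}

/-- The tile number `i` of a chain. -/
def tile (C : LatticeChain T x y) (i : ℕ) : Tile :=
  ⟨C.zx i, C.zy i, i, T.stops.map (Visit.copy (C.pose i) (C.zx i) (C.zy i) i (C.rev i))⟩

theorem not_occupied (C : LatticeChain T x y) {i : ℕ} (hi : i < 32) (l : List Tile)
    (hl : ∀ t ∈ l, ∃ j < 32, j ≠ i ∧ t = C.tile j) : occupied (C.zx i) (C.zy i) l = false := by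
  induction l with
  | nil => rfl
  | cons t l ih =>
    replace ih := ih fun t' ht' => hl t' (by simp [ht'])
    obtain ⟨j, hj, hji, rfl⟩ := hl t (by simp)
    change Bool.rec (motive := fun _ => Bool) (occupied (C.zx i) (C.zy i) l)
      (Bool.rec (motive := fun _ => Bool) (occupied (C.zx i) (C.zy i) l) true
        (Nat.beq (C.zy j) (C.zy i))) (Nat.beq (C.zx j) (C.zx i)) = false
    rw [ih]
    cases h1 : Nat.beq (C.zx j) (C.zx i)
    · rfl
    · cases h2 : Nat.beq (C.zy j) (C.zy i)
      · rfl
      · have h1' := Nat.eq_of_beq_eq_true h1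
        have h2' := Nat.eq_of_beq_eq_true h2
        rcases lt_or_gt_of_ne hji with h | h
        · exact absurd ⟨h1', h2'⟩ (C.injective j i h hi)
        · exact absurd ⟨h1'.symm, h2'.symm⟩ (C.injective i j h hj)

/-- The step of the search that adds the tile number `i` of the chain. -/
theorem exists_holds_of_prolong (C : LatticeChain T x y) {fw : Bool} {fx fy i : ℕ}
    {next : ℕ → ℕ → List Tile → Bounds → Bool}
    {tiles : List Tile} {b : Bounds} (hi : i < 32) (hb : b.Holds x y)
    (hq : bif fw then 16 ≤ C.zx i ∧ 16 ≤ C.zy i else C.zx i < 16 ∧ C.zy i < 16)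
    (htiles : ∀ t ∈ tiles, ∃ j < 32, (bif fw then j < i else i < j) ∧ t = C.tile j)
    (hfx : fx = 2 * C.zx i + (bif C.rev i != fw then (C.pose i).fst 2 0 0
      else (C.pose i).fst 2 T.exitX T.exitY))
    (hfy : fy = 2 * C.zy i + (bif C.rev i != fw then (C.pose i).snd 2 0 0
      else (C.pose i).snd 2 T.exitX T.exitY))
    (h : prolong T fw fx fy i next tiles b = true) :
    ∃ b' : Bounds, b'.Holds x y ∧
      next (2 * C.zx i + (bif C.rev i != fw then (C.pose i).fst 2 T.exitX T.exitY
          else (C.pose i).fst 2 0 0))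
        (2 * C.zy i + (bif C.rev i != fw then (C.pose i).snd 2 T.exitX T.exitY
          else (C.pose i).snd 2 0 0)) (C.tile i :: tiles) b' = true := by
  have h1 := of_allPoses h (C.pose i) (C.rev i)
  have hocc : occupied (C.zx i) (C.zy i) tiles = false := by
    refine C.not_occupied hi tiles fun t ht => ?_
    obtain ⟨j, hj, hji, rfl⟩ := htiles t ht
    exact ⟨j, hj, by cases fw <;> simp only [cond_true, cond_false] at hji <;> omega, rfl⟩
  have hquad : (bif fw then Nat.ble (C.zx i) 15 || Nat.ble (C.zy i) 15
      else Nat.ble 16 (C.zx i) || Nat.ble 16 (C.zy i)) = false := by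
    have key : ∀ m n : ℕ, n < m → Nat.ble m n = false := fun m n hmn => by
      rw [← Bool.not_eq_true, Nat.ble_eq]
      exact not_le.mpr hmn
    cases fw
    · rw [cond_false, key _ _ hq.1, key _ _ hq.2]
      rfl
    · rw [cond_true, key _ _ (Nat.lt_of_succ_le hq.1), key _ _ (Nat.lt_of_succ_le hq.2)]
      rfl
  have hsub : ∀ z m : ℕ, Nat.sub (2 * z + m) m = 2 * z := fun z m => Nat.add_sub_cancel (2 * z) m
  have hmod : ∀ z : ℕ, Nat.mod (2 * z) 2 = 0 := fun z => Nat.mul_mod_right 2 z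
  have hdiv : ∀ z : ℕ, Nat.div (2 * z) 2 = z := fun z => Nat.mul_div_cancel_left z two_pos
  simp only [force_eq, bool_rec_eq_bif, hfx, hfy, hsub, hmod, hdiv, hquad, hocc, Bool.or_false,
    cond_false, show Nat.beq 0 1 = false from rfl] at h1
  refine exists_holds_of_compareTiles hb ?_ h1
  intro t ht v hv w hw
  obtain ⟨j, hj, hji, rfl⟩ := htiles t ht
  obtain ⟨v', hv', rfl⟩ := List.mem_map.mp hv
  obtain ⟨w', hw', rfl⟩ := List.mem_map.mp hw
  cases fw
  · exact C.sep i j hji hj v' hv' w' hw'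
  · exact C.sep j i hji hi w' hw' v' hv'

/-- The invariants of the search along the chain `C`: the tiles with numbers between `lo` and `hi` are
placed, and the bounds hold. The search therefore cannot end with contradictory bounds. -/
theorem explore_false (C : LatticeChain T x y) (sched : List Bool)
    (fx fy hi gx gy lo : ℕ) (tiles : List Tile) (b : Bounds)
    (hlo : sched.length ≤ lo) (hlo' : lo < 16) (hhi : hi + 1 + sched.length ≤ 32) (hhi' : 16 ≤ hi)
    (hb : b.Holds x y) (htiles : ∀ t ∈ tiles, ∃ j, lo < j ∧ j ≤ hi ∧ t = C.tile j)
    (hfx : fx = 2 * C.zx hi + (bif C.rev hi then (C.pose hi).fst 2 0 0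
      else (C.pose hi).fst 2 T.exitX T.exitY))
    (hfy : fy = 2 * C.zy hi + (bif C.rev hi then (C.pose hi).snd 2 0 0
      else (C.pose hi).snd 2 T.exitX T.exitY))
    (hgx : gx = 2 * C.zx (lo + 1) + (bif C.rev (lo + 1) then
      (C.pose (lo + 1)).fst 2 T.exitX T.exitY else (C.pose (lo + 1)).fst 2 0 0))
    (hgy : gy = 2 * C.zy (lo + 1) + (bif C.rev (lo + 1) then
      (C.pose (lo + 1)).snd 2 T.exitX T.exitY else (C.pose (lo + 1)).snd 2 0 0)) :
    explore T sched fx fy (hi + 1) gx gy lo tiles b = false := by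
  induction sched generalizing fx fy hi gx gy lo tiles b with
  | nil => rfl
  | cons fw sched ih =>
    rw [← Bool.not_eq_true]
    intro h
    rw [List.length_cons] at hlo hhi
    cases fw
    · have h1 : prolong T false gx gy lo
          (fun ox oy => explore T sched fx fy (hi + 1) ox oy (lo - 1)) tiles b = true := h
      rw [← C.junctionX lo (by omega)] at hgx
      rw [← C.junctionY lo (by omega)] at hgy
      obtain ⟨b', hb', h2⟩ := C.exists_holds_of_prolong (fw := false) (by omega) hb
        (C.quadrant_left lo hlo')
        (fun t ht => by
          obtain ⟨j, hj, hj', e⟩ := htiles t ht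
          exact ⟨j, by omega, hj, e⟩)
        (by rw [hgx]; cases C.rev lo <;> rfl) (by rw [hgy]; cases C.rev lo <;> rfl) h1
      have hl : lo - 1 + 1 = lo := by omega
      rw [ih fx fy hi _ _ (lo - 1) _ b' (by omega) (by omega) (by omega) hhi' hb' ?_ hfx hfy
        (by rw [hl]; cases C.rev lo <;> rfl) (by rw [hl]; cases C.rev lo <;> rfl)] at h2
      · exact absurd h2 (by simp)
      · intro t ht
        rcases List.mem_cons.mp ht with rfl | ht
        · exact ⟨lo, by omega, by omega, rfl⟩
        · obtain ⟨j, hj, hj', e⟩ := htiles t ht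
          exact ⟨j, by omega, hj', e⟩
    · have h1 : prolong T true fx fy (hi + 1)
          (fun ox oy => explore T sched ox oy (hi + 1 + 1) gx gy lo) tiles b = true := h
      rw [C.junctionX hi (by omega)] at hfx
      rw [C.junctionY hi (by omega)] at hfy
      obtain ⟨b', hb', h2⟩ := C.exists_holds_of_prolong (fw := true) (by omega) hb
        (C.quadrant_right (hi + 1) (by omega) (by omega))
        (fun t ht => by
          obtain ⟨j, hj, hj', e⟩ := htiles t ht
          exact ⟨j, by omega, Nat.lt_succ_of_le hj', e⟩)
        (by rw [hfx]; cases C.rev (hi + 1) <;> rfl) (by rw [hfy]; cases C.rev (hi + 1) <;> rfl) h1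
      rw [ih _ _ (hi + 1) gx gy lo _ b' (by omega) hlo' (by omega) (by omega) hb' ?_
        (by cases C.rev (hi + 1) <;> rfl) (by cases C.rev (hi + 1) <;> rfl) hgx hgy] at h2
      · exact absurd h2 (by simp)
      · intro t ht
        rcases List.mem_cons.mp ht with rfl | ht
        · exact ⟨hi + 1, by omega, le_rfl, rfl⟩
        · obtain ⟨j, hj, hj', e⟩ := htiles t ht
          exact ⟨j, hj, by omega, e⟩

/-- A successful search excludes the existence of a chain. -/
theorem refutes_eq_false (C : LatticeChain T x y) (sched : List Bool) (hs : sched.length ≤ 15) :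
    refutes T sched = false := by
  have hb := Bounds.holds_ofVisits C.mem_x C.mem_y C.pairwise
  refine C.explore_false sched _ _ 16 _ _ 15 _ _ hs (by omega) (by omega) le_rfl hb ?_ ?_ ?_ ?_ ?_
  · intro t ht
    rw [List.mem_singleton] at ht
    refine ⟨16, by omega, le_rfl, ?_⟩
    rw [ht, tile, C.zx_base, C.zy_base, C.pose_base, C.rev_base]
  all_goals
    simp only [C.zx_base, C.zy_base, C.pose_base, C.rev_base]
    rfl

end LatticeChain

/-! ### The algebra of poses -/

namespace Pose

/-- The composition of two symmetries of a square, the second one being applied first. -/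
def mul (p q : Pose) : Pose :=
  ⟨p.swap != q.swap, p.flipX != (bif p.swap then q.flipY else q.flipX),
    p.flipY != (bif p.swap then q.flipX else q.flipY)⟩

/-- The inverse of a symmetry of a square. -/
def inv (p : Pose) : Pose :=
  ⟨p.swap, bif p.swap then p.flipY else p.flipX, bif p.swap then p.flipX else p.flipY⟩

/-- The symmetry followed by the exchange of the coordinates. -/
def swapped (p : Pose) : Pose := ⟨!p.swap, p.flipY, p.flipX⟩

theorem mul_inv (p : Pose) : p.mul p.inv = one := by
  rcases p with ⟨_ | _, _ | _, _ | _⟩ <;> rfl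

theorem fst_mul {R : Type} [CommRing R] (p q : Pose) (a x y : R) :
    (p.mul q).fst a x y = p.fst a (q.fst a x y) (q.snd a x y) := by
  rcases p with ⟨_ | _, _ | _, _ | _⟩ <;> rcases q with ⟨_ | _, _ | _, _ | _⟩ <;>
    simp [mul, fst, snd]

theorem snd_mul {R : Type} [CommRing R] (p q : Pose) (a x y : R) :
    (p.mul q).snd a x y = p.snd a (q.fst a x y) (q.snd a x y) := by
  rcases p with ⟨_ | _, _ | _, _ | _⟩ <;> rcases q with ⟨_ | _, _ | _, _ | _⟩ <;>
    simp [mul, fst, snd]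

theorem fst_inv {R : Type} [CommRing R] (p : Pose) (a x y : R) :
    p.inv.fst a (p.fst a x y) (p.snd a x y) = x := by
  rcases p with ⟨_ | _, _ | _, _ | _⟩ <;> simp [inv, fst, snd]

theorem snd_inv {R : Type} [CommRing R] (p : Pose) (a x y : R) :
    p.inv.snd a (p.fst a x y) (p.snd a x y) = y := by
  rcases p with ⟨_ | _, _ | _, _ | _⟩ <;> simp [inv, fst, snd]

theorem fst_fst_inv {R : Type} [CommRing R] (p : Pose) (a x y : R) :
    p.fst a (p.inv.fst a x y) (p.inv.snd a x y) = x := by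
  rcases p with ⟨_ | _, _ | _, _ | _⟩ <;> simp [inv, fst, snd]

theorem snd_fst_inv {R : Type} [CommRing R] (p : Pose) (a x y : R) :
    p.snd a (p.inv.fst a x y) (p.inv.snd a x y) = y := by
  rcases p with ⟨_ | _, _ | _, _ | _⟩ <;> simp [inv, fst, snd]

theorem fst_swapped {R : Type} [Sub R] (p : Pose) (a x y : R) :
    p.swapped.fst a x y = p.snd a x y := by
  rcases p with ⟨_ | _, _ | _, _ | _⟩ <;> rfl

theorem snd_swapped {R : Type} [Sub R] (p : Pose) (a x y : R) :
    p.swapped.snd a x y = p.fst a x y := by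
  rcases p with ⟨_ | _, _ | _, _ | _⟩ <;> rfl

theorem fst_add (p : Pose) (q z w x y : ℝ) :
    p.fst q (z + x) (w + y) = p.fst (q - 1) z w + p.fst 1 x y := by
  rcases p with ⟨_ | _, _ | _, _ | _⟩ <;> simp [fst] <;> ring

theorem snd_add (p : Pose) (q z w x y : ℝ) :
    p.snd q (z + x) (w + y) = p.snd (q - 1) z w + p.snd 1 x y := by
  rcases p with ⟨_ | _, _ | _, _ | _⟩ <;> simp [snd] <;> ring

theorem mul_fst (p : Pose) (q x y : ℝ) : q * p.fst 1 x y = p.fst q (q * x) (q * y) := by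
  rcases p with ⟨_ | _, _ | _, _ | _⟩ <;> simp [fst] <;> ring

theorem mul_snd (p : Pose) (q x y : ℝ) : q * p.snd 1 x y = p.snd q (q * x) (q * y) := by
  rcases p with ⟨_ | _, _ | _, _ | _⟩ <;> simp [snd] <;> ring

theorem fst_intCast (p : Pose) (a x y : ℤ) : ((p.fst a x y : ℤ) : ℝ) = p.fst (a : ℝ) x y := by
  rcases p with ⟨_ | _, _ | _, _ | _⟩ <;> simp [fst]

theorem snd_intCast (p : Pose) (a x y : ℤ) : ((p.snd a x y : ℤ) : ℝ) = p.snd (a : ℝ) x y := by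
  rcases p with ⟨_ | _, _ | _, _ | _⟩ <;> simp [snd]

theorem fst_natCast {R : Type} [CommRing R] (p : Pose) {a x y : ℕ} (hx : x ≤ a) (hy : y ≤ a) :
    ((p.fst a x y : ℕ) : R) = p.fst (a : R) x y := by
  rcases p with ⟨_ | _, _ | _, _ | _⟩ <;> simp [fst, hx, hy]

theorem snd_natCast {R : Type} [CommRing R] (p : Pose) {a x y : ℕ} (hx : x ≤ a) (hy : y ≤ a) :
    ((p.snd a x y : ℕ) : R) = p.snd (a : R) x y := by
  rcases p with ⟨_ | _, _ | _, _ | _⟩ <;> simp [snd, hx, hy]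

theorem fst_mem_Icc (p : Pose) {x y : ℝ} (hx : x ∈ Icc (0 : ℝ) 1) (hy : y ∈ Icc (0 : ℝ) 1) :
    p.fst 1 x y ∈ Icc (0 : ℝ) 1 := by
  obtain ⟨h1, h2⟩ := hx
  obtain ⟨h3, h4⟩ := hy
  rcases p with ⟨_ | _, _ | _, _ | _⟩ <;> simp only [fst, cond_true, cond_false] <;>
    constructor <;> linarith

theorem snd_mem_Icc (p : Pose) {x y : ℝ} (hx : x ∈ Icc (0 : ℝ) 1) (hy : y ∈ Icc (0 : ℝ) 1) :
    p.snd 1 x y ∈ Icc (0 : ℝ) 1 := by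
  rw [← fst_swapped]
  exact p.swapped.fst_mem_Icc hx hy

end Pose

/-! ### Codes of coordinates -/

/-- The code of a coordinate: twice the coordinate if this is an integer, and otherwise the odd
integer between its neighbours of this kind. -/
noncomputable def mark (x : ℝ) : ℤ := ⌊x⌋ + ⌈x⌉

theorem mark_add (z : ℤ) (x : ℝ) : mark (z + x) = 2 * z + mark x := by
  rw [mark, mark, Int.floor_intCast_add, Int.ceil_intCast_add]
  ring

theorem mark_one_sub (x : ℝ) : mark (1 - x) = 2 - mark x := by
  have h1 : ⌊1 - x⌋ = 1 - ⌈x⌉ := by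
    rw [show 1 - x = ((1 : ℤ) : ℝ) + -x by push_cast; ring, Int.floor_intCast_add, Int.floor_neg]
    ring
  have h2 : ⌈1 - x⌉ = 1 - ⌊x⌋ := by
    rw [sub_eq_add_neg, add_comm, Int.ceil_add_one, Int.ceil_neg]
    ring
  rw [mark, mark, h1, h2]
  ring

theorem mark_fst (p : Pose) (x y : ℝ) : mark (p.fst 1 x y) = p.fst 2 (mark x) (mark y) := by
  rcases p with ⟨_ | _, _ | _, _ | _⟩ <;> simp [Pose.fst, mark_one_sub]

theorem mark_zero : mark 0 = 0 := by simp [mark]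

theorem exists_natCast_eq_mark {x : ℝ} (hx : x ∈ Icc (0 : ℝ) 1) :
    ∃ e : ℕ, (e : ℤ) = mark x ∧ e ≤ 2 ∧ (e = 0 → x = 0) ∧ (e = 2 → x = 1) := by
  obtain ⟨h0, h1⟩ := hx
  rcases h0.eq_or_lt with rfl | h0
  · exact ⟨0, by simp [mark], by omega, fun _ => rfl, fun h => absurd h (by omega)⟩
  rcases h1.eq_or_lt with rfl | h1
  · exact ⟨2, by simp [mark], by omega, fun h => absurd h (by omega), fun _ => rfl⟩
  refine ⟨1, ?_, by omega, fun h => absurd h (by omega), fun h => absurd h (by omega)⟩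
  have h2 : ⌊x⌋ = 0 := Int.floor_eq_iff.mpr ⟨by simpa using h0.le, by simpa using h1⟩
  have h3 : ⌈x⌉ = 1 := Int.ceil_eq_iff.mpr ⟨by simpa using h0, by simpa using h1.le⟩
  rw [mark, h2, h3]
  rfl

/-! ### Chains of copies of a curve -/

/-- The time `u` of the unit interval, counted from the end if `r` holds. -/
def fromEnd (r : Bool) (u : ℝ) : ℝ := bif r then 1 - u else u

theorem fromEnd_mem {r : Bool} {u : ℝ} (hu : u ∈ Icc (0 : ℝ) 1) : fromEnd r u ∈ Icc (0 : ℝ) 1 := by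
  obtain ⟨h0, h1⟩ := hu
  cases r
  · exact ⟨h0, h1⟩
  · exact ⟨sub_nonneg.mpr h1, sub_le_self 1 h0⟩

@[simp] theorem fromEnd_fromEnd (r r' : Bool) (u : ℝ) :
    fromEnd r (fromEnd r' u) = fromEnd (r != r') u := by
  cases r <;> cases r' <;> simp [fromEnd]

/-- A curve `(X, Y)` through 32 distinct squares of the lattice, the coordinates being chosen such
that the curve passes at the time 16 through `(16, 16)` from one quadrant to the opposite one. Each
unit of time is a copy of the base curve, which is that between the times 16 and 17, moved to
`[0, 1]²`. The Euclidean dilation is less than `17/3`. -/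
structure NormalizedCurve where
  X : ℝ → ℝ
  Y : ℝ → ℝ
  pose : ℕ → Pose
  zx : ℕ → ℕ
  zy : ℕ → ℕ
  rev : ℕ → Bool
  copyX : ∀ i : ℕ, i < 32 → ∀ u ∈ Icc (0 : ℝ) 1, X (i + u) = zx i +
    (pose i).fst 1 (X (16 + fromEnd (rev i) u) - 16) (Y (16 + fromEnd (rev i) u) - 16)
  copyY : ∀ i : ℕ, i < 32 → ∀ u ∈ Icc (0 : ℝ) 1, Y (i + u) = zy i +
    (pose i).snd 1 (X (16 + fromEnd (rev i) u) - 16) (Y (16 + fromEnd (rev i) u) - 16)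
  pose_base : pose 16 = Pose.one
  zx_base : zx 16 = 16
  zy_base : zy 16 = 16
  rev_base : rev 16 = false
  quadrant_right : ∀ i, 16 ≤ i → i < 32 → 16 ≤ zx i ∧ 16 ≤ zy i
  quadrant_left : ∀ i < 16, zx i < 16 ∧ zy i < 16
  injective : ∀ i j, i < j → j < 32 → ¬ (zx i = zx j ∧ zy i = zy j)
  startX : X 16 = 16
  startY : Y 16 = 16
  memX : ∀ u ∈ Icc (0 : ℝ) 1, X (16 + u) - 16 ∈ Icc (0 : ℝ) 1
  memY : ∀ u ∈ Icc (0 : ℝ) 1, Y (16 + u) - 16 ∈ Icc (0 : ℝ) 1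
  onto : ∀ a ∈ Icc (0 : ℝ) 1, ∀ b ∈ Icc (0 : ℝ) 1, ∃ u ∈ Icc (0 : ℝ) 1,
    X (16 + u) - 16 = a ∧ Y (16 + u) - 16 = b
  dilation : ∀ t t', 0 ≤ t → t < t' → t' ≤ 32 →
    3 * ((X t - X t') ^ 2 + (Y t - Y t') ^ 2) < 17 * (t' - t)

namespace NormalizedCurve

/-- The curve with exchanged coordinates. -/
def swapped (C : NormalizedCurve) : NormalizedCurve where
  X := C.Y
  Y := C.X
  pose i := ((C.pose i).mul ⟨true, false, false⟩).swapped
  zx := C.zy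
  zy := C.zx
  rev := C.rev
  copyX i hi u hu := by
    rw [C.copyY i hi u hu, Pose.fst_swapped, Pose.snd_mul]
    rfl
  copyY i hi u hu := by
    rw [C.copyX i hi u hu, Pose.snd_swapped, Pose.fst_mul]
    rfl
  pose_base := by rw [C.pose_base]; rfl
  zx_base := C.zy_base
  zy_base := C.zx_base
  rev_base := C.rev_base
  quadrant_right i h h' := (C.quadrant_right i h h').symm
  quadrant_left i h := (C.quadrant_left i h).symm
  injective i j h h' e := C.injective i j h h' e.symm
  startX := C.startY
  startY := C.startX
  memX := C.memY
  memY := C.memX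
  onto a ha b hb := by
    obtain ⟨u, hu, h1, h2⟩ := C.onto b hb a ha
    exact ⟨u, hu, h2, h1⟩
  dilation t t' h0 h h1 := by
    rw [add_comm]
    exact C.dilation t t' h0 h h1

/-- The curve is at the point `(a, b)` of the square `[0, 1]²` when the fraction `u` of the base curve
is over. -/
def Base (C : NormalizedCurve) (u a b : ℝ) : Prop :=
  u ∈ Icc (0 : ℝ) 1 ∧ C.X (16 + u) - 16 = a ∧ C.Y (16 + u) - 16 = b

/-- The visit `v` of a vertex by the base curve is real if the unknown times are `x` and `y`. -/
def Stop (C : NormalizedCurve) (x y : ℝ) (v : Visit) : Prop :=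
  v.X ≤ 1 ∧ v.Y ≤ 1 ∧ v.K ≤ 17 ∧ C.Base (v.time x y / 17) v.X v.Y

theorem sep_of_le (C : NormalizedCurve) {x y t t' c d : ℝ} {v w : Visit} (h0 : 0 ≤ t)
    (h : t ≤ t') (h1 : t' ≤ 32) (hv : v.time x y + c = 17 * t) (hw : w.time x y + c = 17 * t')
    (hvX : C.X t = v.X + d) (hvY : C.Y t = v.Y + d) (hwX : C.X t' = w.X + d)
    (hwY : C.Y t' = w.Y + d) : v.Sep x y w := by
  intro hne
  have hlt : t < t' := by
    refine h.lt_of_ne fun e => hne ?_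
    subst e
    constructor
    · exact_mod_cast (add_right_cancel (hvX.symm.trans hwX) : (v.X : ℝ) = w.X)
    · exact_mod_cast (add_right_cancel (hvY.symm.trans hwY) : (v.Y : ℝ) = w.Y)
  have h3 := C.dilation t t' h0 hlt h1
  rw [hvX, hvY, hwX, hwY] at h3
  have e : ((v.X : ℝ) + d - (w.X + d)) ^ 2 + ((v.Y : ℝ) + d - (w.Y + d)) ^ 2 =
      ((v.X : ℝ) - w.X) ^ 2 + ((v.Y : ℝ) - w.Y) ^ 2 := by ring
  rw [e] at h3
  linarith

/-- Stops of the base curve in the order of time satisfy the bounds for the dilation. -/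
theorem Stop.sep {C : NormalizedCurve} {x y : ℝ} {v w : Visit} (hv : C.Stop x y v)
    (hw : C.Stop x y w) (h : v.time x y ≤ w.time x y) : v.Sep x y w := by
  obtain ⟨-, -, -, ⟨hv0, hv1⟩, hvX, hvY⟩ := hv
  obtain ⟨-, -, -, ⟨hw0, hw1⟩, hwX, hwY⟩ := hw
  exact C.sep_of_le (t := 16 + v.time x y / 17) (t' := 16 + w.time x y / 17) (c := 272) (d := 16)
    (by linarith) (by linarith) (by linarith) (by ring) (by ring) (by linarith) (by linarith)
    (by linarith) (by linarith)

/-- The copy of a stop is a visit of the curve. -/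
theorem Stop.copy {C : NormalizedCurve} {x y : ℝ} {v : Visit} (hv : C.Stop x y v) {i : ℕ}
    (hi : i < 32) : ∃ u ∈ Icc (0 : ℝ) 1,
      (v.copy (C.pose i) (C.zx i) (C.zy i) i (C.rev i)).time x y = 17 * (i + u) ∧
      C.X (i + u) = (v.copy (C.pose i) (C.zx i) (C.zy i) i (C.rev i)).X ∧
      C.Y (i + u) = (v.copy (C.pose i) (C.zx i) (C.zy i) i (C.rev i)).Y := by
  obtain ⟨h1, h2, h3, h4, hX, hY⟩ := hv
  refine ⟨fromEnd (C.rev i) (v.time x y / 17), fromEnd_mem h4, ?_, ?_, ?_⟩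
  · cases hr : C.rev i
    · simp only [Visit.copy, Visit.time, fromEnd, cond_false]
      push_cast
      ring
    · simp only [Visit.copy, Visit.time, fromEnd, cond_true, Phase.val_neg]
      push_cast [h3]
      ring
  · rw [C.copyX i hi _ (fromEnd_mem h4), fromEnd_fromEnd, bne_self_eq_false]
    simp only [fromEnd, cond_false]
    rw [hX, hY]
    simp only [Visit.copy]
    push_cast [Pose.fst_natCast (R := ℝ) _ h1 h2]
    rfl
  · rw [C.copyY i hi _ (fromEnd_mem h4), fromEnd_fromEnd, bne_self_eq_false]
    simp only [fromEnd, cond_false]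
    rw [hX, hY]
    simp only [Visit.copy]
    push_cast [Pose.snd_natCast (R := ℝ) _ h1 h2]
    rfl

theorem mark_X (C : NormalizedCurve) {i : ℕ} (hi : i < 32) {u : ℝ} (hu : u ∈ Icc (0 : ℝ) 1) :
    mark (C.X (i + u)) = 2 * C.zx i + (C.pose i).fst 2 (mark (C.X (16 + fromEnd (C.rev i) u) - 16))
      (mark (C.Y (16 + fromEnd (C.rev i) u) - 16)) := by
  rw [C.copyX i hi u hu, ← mark_fst]
  exact mark_add (C.zx i) _

theorem mark_Y (C : NormalizedCurve) {i : ℕ} (hi : i < 32) {u : ℝ} (hu : u ∈ Icc (0 : ℝ) 1) :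
    mark (C.Y (i + u)) = 2 * C.zy i + (C.pose i).snd 2 (mark (C.X (16 + fromEnd (C.rev i) u) - 16))
      (mark (C.Y (16 + fromEnd (C.rev i) u) - 16)) :=
  C.swapped.mark_X hi hu |>.trans (by
    change 2 * (C.zy i : ℤ) + ((C.pose i).mul ⟨true, false, false⟩).swapped.fst 2 _ _ = _
    rw [Pose.fst_swapped, Pose.snd_mul]
    rfl)

/-- A curve whose base curve has the stops of an itinerary gives a chain of tiles. -/
def toLatticeChain (C : NormalizedCurve) {T : Itinerary} {x y : ℝ} (hx : x ∈ Icc (0 : ℝ) 17)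
    (hy : y ∈ Icc (0 : ℝ) 17) (hT : ∀ v ∈ T.stops, C.Stop x y v)
    (hT' : T.stops.Pairwise fun v w => v.time x y ≤ w.time x y)
    (hX : (T.exitX : ℤ) = mark (C.X 17 - 16)) (hY : (T.exitY : ℤ) = mark (C.Y 17 - 16))
    (hX' : T.exitX ≤ 2) (hY' : T.exitY ≤ 2) : LatticeChain T x y where
  pose := C.pose
  zx := C.zx
  zy := C.zy
  rev := C.rev
  pose_base := C.pose_base
  zx_base := C.zx_base
  zy_base := C.zy_base
  rev_base := C.rev_base
  quadrant_right := C.quadrant_right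
  quadrant_left := C.quadrant_left
  injective := C.injective
  junctionX i hi := by
    have h1 := C.mark_X (i := i) (by omega) (right_mem_Icc.mpr zero_le_one)
    have h2 := C.mark_X (i := i + 1) (by omega) (left_mem_Icc.mpr zero_le_one)
    rw [show ((i + 1 : ℕ) : ℝ) + 0 = i + 1 by push_cast; ring, h1] at h2
    zify
    cases hr : C.rev i <;> cases hr' : C.rev (i + 1) <;>
      simp only [hr, hr', fromEnd, cond_true, cond_false, sub_zero, sub_self, add_zero, C.startX,
        C.startY, mark_zero, show (16 : ℝ) + 1 = 17 by norm_num, ← hX, ← hY] at h2 ⊢ <;>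
      simpa [Pose.fst_natCast (R := ℤ) _ hX' hY',
        Pose.fst_natCast (R := ℤ) _ (Nat.zero_le 2) (Nat.zero_le 2)] using h2
  junctionY i hi := by
    have h1 := C.mark_Y (i := i) (by omega) (right_mem_Icc.mpr zero_le_one)
    have h2 := C.mark_Y (i := i + 1) (by omega) (left_mem_Icc.mpr zero_le_one)
    rw [show ((i + 1 : ℕ) : ℝ) + 0 = i + 1 by push_cast; ring, h1] at h2
    zify
    cases hr : C.rev i <;> cases hr' : C.rev (i + 1) <;>
      simp only [hr, hr', fromEnd, cond_true, cond_false, sub_zero, sub_self, add_zero, C.startX,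
        C.startY, mark_zero, show (16 : ℝ) + 1 = 17 by norm_num, ← hX, ← hY] at h2 ⊢ <;>
      simpa [Pose.snd_natCast (R := ℤ) _ hX' hY',
        Pose.snd_natCast (R := ℤ) _ (Nat.zero_le 2) (Nat.zero_le 2)] using h2
  mem_x := hx
  mem_y := hy
  pairwise := by
    refine List.Pairwise.imp_of_mem ?_ hT'
    intro v w hv hw h
    exact (hT v hv).sep (hT w hw) h
  sep i j hij hj v hv w hw := by
    obtain ⟨u, ⟨hu0, hu1⟩, h1, h2, h3⟩ := (hT v hv).copy (hij.trans hj)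
    obtain ⟨u', ⟨hu0', hu1'⟩, h1', h2', h3'⟩ := (hT w hw).copy hj
    have hij' : (i : ℝ) + 1 ≤ j := by exact_mod_cast hij
    have hj' : (j : ℝ) + 1 ≤ 32 := by exact_mod_cast hj
    have hi0 : (0 : ℝ) ≤ i := i.cast_nonneg
    exact C.sep_of_le (t := i + u) (t' := j + u') (c := 0) (d := 0) (by linarith) (by linarith)
      (by linarith) (by linarith) (by linarith) (by linarith) (by linarith) (by linarith)
      (by linarith)

end NormalizedCurve

namespace NormalizedCurve

theorem stop_start (C : NormalizedCurve) (x y : ℝ) : C.Stop x y Visit.start := by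
  refine ⟨by decide, by decide, by decide, ?_, ?_, ?_⟩ <;>
    simp [Visit.time, Visit.start, Phase.val, C.startX, C.startY]

theorem Base.stop_x {C : NormalizedCurve} {u : ℝ} {a b : ℕ} (h : C.Base u a b) (ha : a ≤ 1)
    (hb : b ≤ 1) (y : ℝ) : C.Stop (17 * u) y ⟨a, b, 0, .x⟩ :=
  ⟨ha, hb, Nat.zero_le _, by simpa [Visit.time, Phase.val] using h⟩

theorem Base.stop_y {C : NormalizedCurve} {v : ℝ} {a b : ℕ} (h : C.Base v a b) (ha : a ≤ 1)
    (hb : b ≤ 1) (x : ℝ) : C.Stop x (17 * v) ⟨a, b, 0, .y⟩ :=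
  ⟨ha, hb, Nat.zero_le _, by simpa [Visit.time, Phase.val] using h⟩

theorem Base.stop_end {C : NormalizedCurve} {a b : ℕ} (h : C.Base 1 a b) (ha : a ≤ 1)
    (hb : b ≤ 1) (x y : ℝ) : C.Stop x y ⟨a, b, 17, .const⟩ :=
  ⟨ha, hb, le_rfl, by simpa [Visit.time, Phase.val] using h⟩

theorem Base.scaled_mem {C : NormalizedCurve} {u a b : ℝ} (h : C.Base u a b) :
    17 * u ∈ Icc (0 : ℝ) 17 := by
  obtain ⟨⟨h0, h1⟩, -⟩ := h
  constructor <;> linarith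

/-- A successful search excludes a base curve whose end point has the given code, and which visits
two vertices in the given order. -/
theorem false_of_code (C : NormalizedCurve) {X₁ Y₁ X₂ Y₂ eX eY : ℕ} {u v : ℝ} {sched : List Bool}
    (h : refutes (.ofCode X₁ Y₁ X₂ Y₂ eX eY) sched = true) (hs : sched.length ≤ 15)
    (h₁ : X₁ ≤ 1 ∧ Y₁ ≤ 1) (h₂ : X₂ ≤ 1 ∧ Y₂ ≤ 1) (hu : C.Base u X₁ Y₁) (hv : C.Base v X₂ Y₂)
    (huv : u ≤ v) (hX : (eX : ℤ) = mark (C.X 17 - 16)) (hY : (eY : ℤ) = mark (C.Y 17 - 16))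
    (hX' : eX ≤ 2) (hY' : eY ≤ 2) : False := by
  have hs0 := C.stop_start (17 * u) (17 * v)
  have hs1 := hu.stop_x h₁.1 h₁.2 (17 * v)
  have hs2 := hv.stop_y h₂.1 h₂.2 (17 * u)
  have hu0 := hu.scaled_mem.1
  have hv0 := hv.scaled_mem.1
  have D := C.toLatticeChain (T := .ofCode X₁ Y₁ X₂ Y₂ eX eY) hu.scaled_mem hv.scaled_mem
    (by
      simp only [Itinerary.ofCode, List.forall_mem_cons, List.not_mem_nil, false_imp_iff,
        implies_true, and_true]
      exact ⟨hs0, hs1, hs2⟩)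
    (by
      simp only [Itinerary.ofCode, List.pairwise_cons, List.forall_mem_cons, List.not_mem_nil,
        false_imp_iff, implies_true, and_true, List.Pairwise.nil, Visit.time, Visit.start, Phase.val]
      norm_num
      refine ⟨⟨?_, ?_⟩, ?_⟩ <;> linarith)
    hX hY hX' hY'
  rw [D.refutes_eq_false sched hs] at h
  exact absurd h (by simp)

/-- A successful search excludes a base curve that ends at the given vertex, and visits two vertices
in the given order. -/
theorem false_of_vertices (C : NormalizedCurve) {X₁ Y₁ X₂ Y₂ X Y : ℕ} {u v : ℝ}
    {sched : List Bool} (h : refutes (.ofVertices X₁ Y₁ X₂ Y₂ X Y) sched = true)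
    (hs : sched.length ≤ 15) (h₁ : X₁ ≤ 1 ∧ Y₁ ≤ 1) (h₂ : X₂ ≤ 1 ∧ Y₂ ≤ 1) (h₃ : X ≤ 1 ∧ Y ≤ 1)
    (hu : C.Base u X₁ Y₁) (hv : C.Base v X₂ Y₂) (hw : C.Base 1 X Y) (huv : u ≤ v) : False := by
  have hs0 := C.stop_start (17 * u) (17 * v)
  have hs1 := hu.stop_x h₁.1 h₁.2 (17 * v)
  have hs2 := hv.stop_y h₂.1 h₂.2 (17 * u)
  have hs3 := hw.stop_end h₃.1 h₃.2 (17 * u) (17 * v)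
  obtain ⟨hu0, hu1⟩ := hu.scaled_mem
  obtain ⟨hv0, hv1⟩ := hv.scaled_mem
  have hmark : ∀ n : ℕ, mark n = 2 * n := fun n => by
    rw [mark, Int.floor_natCast, Int.ceil_natCast]
    ring
  have e17 : (16 : ℝ) + 1 = 17 := by norm_num
  have D := C.toLatticeChain (T := .ofVertices X₁ Y₁ X₂ Y₂ X Y) hu.scaled_mem hv.scaled_mem
    (by
      simp only [Itinerary.ofVertices, List.forall_mem_cons, List.not_mem_nil, false_imp_iff,
        implies_true, and_true]
      exact ⟨hs0, hs1, hs2, hs3⟩)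
    (by
      simp only [Itinerary.ofVertices, List.pairwise_cons, List.forall_mem_cons, List.not_mem_nil,
        false_imp_iff, implies_true, and_true, List.Pairwise.nil, Visit.time, Visit.start, Phase.val]
      norm_num
      refine ⟨⟨?_, ?_⟩, ⟨?_, ?_⟩, ?_⟩ <;> linarith)
    (by rw [← e17, hw.2.1, hmark]; simp [Itinerary.ofVertices])
    (by rw [← e17, hw.2.2, hmark]; simp [Itinerary.ofVertices])
    (by simp only [Itinerary.ofVertices]; omega) (by simp only [Itinerary.ofVertices]; omega)
  rw [D.refutes_eq_false sched hs] at h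
  exact absurd h (by simp)

theorem exists_base (C : NormalizedCurve) {a b : ℕ} (ha : a ≤ 1) (hb : b ≤ 1) :
    ∃ u, C.Base u a b := by
  obtain ⟨u, hu, h⟩ := C.onto a ⟨a.cast_nonneg, by exact_mod_cast ha⟩ b
    ⟨b.cast_nonneg, by exact_mod_cast hb⟩
  exact ⟨u, hu, h⟩

theorem Base.swapped {C : NormalizedCurve} {u a b : ℝ} (h : C.Base u a b) :
    C.swapped.Base u b a := ⟨h.1, h.2.2, h.2.1⟩

/-- The base curve does not join adjacent vertices. The unknown times are here those of the visits of
`(0, 1)` and `(1, 1)`, the vertices that are neither its start nor its end. -/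
theorem false_of_side (C : NormalizedCurve) (hw : C.Base 1 1 0) : False := by
  obtain ⟨u, hu⟩ := C.exists_base (a := 0) (b := 1) (by omega) (by omega)
  obtain ⟨v, hv⟩ := C.exists_base (a := 1) (b := 1) (by omega) (by omega)
  have hw' : C.Base 1 (1 : ℕ) (0 : ℕ) := by simpa using hw
  rcases le_total u v with h | h
  · exact C.false_of_vertices refutes_side (by decide) (by decide) (by decide) (by decide) hu hv hw' h
  · exact C.false_of_vertices refutes_side' (by decide) (by decide) (by decide) (by decide) hv hu hw'
      h

/-- There is no such curve with a base curve that visits `(1, 0)` before `(0, 1)`. -/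
theorem false_of_le (C : NormalizedCurve) {u v : ℝ} (hu : C.Base u 1 0) (hv : C.Base v 0 1)
    (h : u ≤ v) : False := by
  have h1 : (1 : ℝ) ∈ Icc (0 : ℝ) 1 := right_mem_Icc.mpr zero_le_one
  have e17 : (16 : ℝ) + 1 = 17 := by norm_num
  obtain ⟨eX, hX, hX2, hX0, hX1⟩ := exists_natCast_eq_mark (C.memX 1 h1)
  obtain ⟨eY, hY, hY2, hY0, hY1⟩ := exists_natCast_eq_mark (C.memY 1 h1)
  have hu' : C.Base u (1 : ℕ) (0 : ℕ) := by simpa using hu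
  have hv' : C.Base v (0 : ℕ) (1 : ℕ) := by simpa using hv
  have main : (eX, eY) ∈ [(0, 0), (0, 1), (1, 0), (1, 1), (1, 2), (2, 1)] → False := fun he =>
    C.false_of_code (refutes_general _ he) (by decide) (by decide) (by decide) hu' hv' h
      (by rw [hX, e17]) (by rw [hY, e17]) hX2 hY2
  interval_cases eX <;> interval_cases eY
  · exact main (by decide)
  · exact main (by decide)
  · exact C.swapped.false_of_side ⟨h1, hY1 rfl, hX0 rfl⟩
  · exact main (by decide)
  · exact main (by decide)
  · exact main (by decide)
  · exact C.false_of_side ⟨h1, hX1 rfl, hY0 rfl⟩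
  · exact main (by decide)
  · refine C.false_of_vertices refutes_diagonal (by decide) (by decide) (by decide) (by decide)
      hu' hv' (X := 1) (Y := 1) ⟨h1, ?_, ?_⟩ h
    · simpa using hX1 rfl
    · simpa using hY1 rfl

/-- A dilation less than `17/3` is incompatible with a diagonal junction. -/
protected theorem false (C : NormalizedCurve) : False := by
  obtain ⟨u, hu⟩ := C.exists_base (a := 1) (b := 0) (by omega) (by omega)
  obtain ⟨v, hv⟩ := C.exists_base (a := 0) (b := 1) (by omega) (by omega)
  rw [Nat.cast_one, Nat.cast_zero] at hu hv
  rcases le_total u v with h | h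
  · exact C.false_of_le hu hv h
  · exact C.swapped.false_of_le hv.swapped hu.swapped h

end NormalizedCurve

/-! ### Isometries of segments and squares -/

theorem sq_norm_eq_add (v : EuclideanSpace ℝ (Fin 2)) : ‖v‖ ^ 2 = v 0 ^ 2 + v 1 ^ 2 := by
  rw [EuclideanSpace.real_norm_sq_eq, Fin.sum_univ_two]

theorem mem_unitCube_two {x : EuclideanSpace ℝ (Fin 2)} :
    x ∈ unitCube 2 ↔ x 0 ∈ Icc (0 : ℝ) 1 ∧ x 1 ∈ Icc (0 : ℝ) 1 := by
  simp only [unitCube, Set.mem_ofPred_eq, Fin.forall_fin_two]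

theorem sq_add_sq_le_one {a b : ℝ} (h1 : |a + b| ≤ 1) (h2 : |a - b| ≤ 1) : a ^ 2 + b ^ 2 ≤ 1 := by
  rw [abs_le] at h1 h2
  nlinarith [mul_nonneg (sub_nonneg.mpr h1.2) (sub_nonneg.mpr h2.2),
    mul_nonneg (sub_nonneg.mpr h1.1) (sub_nonneg.mpr h2.1),
    mul_nonneg (sub_nonneg.mpr h1.2) (sub_nonneg.mpr h1.1),
    mul_nonneg (sub_nonneg.mpr h2.2) (sub_nonneg.mpr h2.1)]

/-- A coordinate of an affine map that takes the unit square into a unit segment `[j, j + 1]`, if its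
linear part is a unit covector: it is one of the coordinates or its reflection. -/
theorem coordinate_form {c a b j : ℝ} (h00 : c ∈ Icc j (j + 1)) (h10 : c + a ∈ Icc j (j + 1))
    (h01 : c + b ∈ Icc j (j + 1)) (h11 : c + a + b ∈ Icc j (j + 1)) (h : a ^ 2 + b ^ 2 = 1) :
    (a = 1 ∧ b = 0 ∧ c = j) ∨ (a = -1 ∧ b = 0 ∧ c = j + 1) ∨ (a = 0 ∧ b = 1 ∧ c = j) ∨
      (a = 0 ∧ b = -1 ∧ c = j + 1) := by
  obtain ⟨p1, p2⟩ := h00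
  obtain ⟨p3, p4⟩ := h10
  obtain ⟨p5, p6⟩ := h01
  obtain ⟨p7, p8⟩ := h11
  have hab : a * b = 0 := by
    have h1 : (a + b) ^ 2 ≤ 1 := by nlinarith
    have h2 : (a - b) ^ 2 ≤ 1 := by nlinarith
    nlinarith
  rcases mul_eq_zero.mp hab with rfl | rfl
  · have : (b - 1) * (b + 1) = 0 := by linarith
    rcases mul_eq_zero.mp this with h | h
    · exact Or.inr (Or.inr (Or.inl ⟨rfl, by linarith, by linarith⟩))
    · exact Or.inr (Or.inr (Or.inr ⟨rfl, by linarith, by linarith⟩))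
  · have : (a - 1) * (a + 1) = 0 := by linarith
    rcases mul_eq_zero.mp this with h | h
    · exact Or.inl ⟨by linarith, rfl, by linarith⟩
    · exact Or.inr (Or.inl ⟨by linarith, rfl, by linarith⟩)

/-- An isometry of the plane that takes the unit square into a square `[j₀, j₀ + 1] × [j₁, j₁ + 1]` is
a symmetry of the unit square followed by a translation. -/
theorem exists_pose_of_isometry (f : EuclideanSpace ℝ (Fin 2) ≃ᵢ EuclideanSpace ℝ (Fin 2))
    (j : Fin 2 → ℝ) (hf : ∀ x ∈ unitCube 2, ∀ i, f x i ∈ Icc (j i) (j i + 1)) :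
    ∃ p : Pose, ∀ x, f x 0 = j 0 + p.fst 1 (x 0) (x 1) ∧ f x 1 = j 1 + p.snd 1 (x 0) (x 1) := by
  set u : EuclideanSpace ℝ (Fin 2) := !₂[1, 0] with hu
  set v : EuclideanSpace ℝ (Fin 2) := !₂[0, 1] with hv
  obtain ⟨L, hL⟩ : ∃ L : EuclideanSpace ℝ (Fin 2) ≃ₗᵢ[ℝ] EuclideanSpace ℝ (Fin 2),
      ∀ x, f x = f 0 + L x := by
    refine ⟨f.toRealAffineIsometryEquiv.linearIsometryEquiv, fun x => ?_⟩
    have := f.toRealAffineIsometryEquiv.map_vadd 0 x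
    simpa [add_comm] using this
  have hx : ∀ x : EuclideanSpace ℝ (Fin 2), x = x 0 • u + x 1 • v := by
    intro x
    ext i
    fin_cases i <;> simp [hu, hv]
  have hform : ∀ x : EuclideanSpace ℝ (Fin 2), ∀ i,
      f x i = f 0 i + x 0 * L u i + x 1 * L v i := by
    intro x i
    conv_lhs => rw [hL x, hx x]
    simp only [map_add, map_smul, PiLp.add_apply, PiLp.smul_apply, smul_eq_mul]
    ring
  have hn : ∀ w : EuclideanSpace ℝ (Fin 2), L w 0 ^ 2 + L w 1 ^ 2 = w 0 ^ 2 + w 1 ^ 2 := by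
    intro w
    rw [← sq_norm_eq_add, ← sq_norm_eq_add, L.norm_map]
  have h1 : L u 0 ^ 2 + L u 1 ^ 2 = 1 := by rw [hn]; simp [hu]
  have h2 : L v 0 ^ 2 + L v 1 ^ 2 = 1 := by rw [hn]; simp [hv]
  have hcorner : ∀ a ∈ ({0, 1} : Set ℝ), ∀ b ∈ ({0, 1} : Set ℝ), ∀ i,
      f 0 i + a * L u i + b * L v i ∈ Icc (j i) (j i + 1) := by
    intro a ha b hb i
    have := hf !₂[a, b] (mem_unitCube_two.mpr ⟨?_, ?_⟩) i
    · rw [hform] at this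
      simpa using this
    · rcases ha with rfl | rfl <;> simp
    · rcases hb with rfl | rfl <;> simp
  have c00 := hcorner 0 (by simp) 0 (by simp)
  have c10 := hcorner 1 (by simp) 0 (by simp)
  have c01 := hcorner 0 (by simp) 1 (by simp)
  have c11 := hcorner 1 (by simp) 1 (by simp)
  simp only [zero_mul, one_mul, add_zero] at c00 c10 c01 c11
  have hle : ∀ i, L u i ^ 2 + L v i ^ 2 ≤ 1 := by
    intro i
    obtain ⟨p1, p2⟩ := c00 i
    obtain ⟨p3, p4⟩ := c10 i
    obtain ⟨p5, p6⟩ := c01 i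
    obtain ⟨p7, p8⟩ := c11 i
    exact sq_add_sq_le_one (abs_le.mpr ⟨by linarith, by linarith⟩)
      (abs_le.mpr ⟨by linarith, by linarith⟩)
  have e0 := coordinate_form (c00 0) (c10 0) (c01 0) (c11 0) (by linarith [hle 0, hle 1])
  have e1 := coordinate_form (c00 1) (c10 1) (c01 1) (c11 1) (by linarith [hle 0, hle 1])
  suffices h : ∃ p : Pose, ∀ x : EuclideanSpace ℝ (Fin 2),
      f 0 0 + x 0 * L u 0 + x 1 * L v 0 = j 0 + p.fst 1 (x 0) (x 1) ∧
      f 0 1 + x 0 * L u 1 + x 1 * L v 1 = j 1 + p.snd 1 (x 0) (x 1) by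
    obtain ⟨p, hp⟩ := h
    exact ⟨p, fun x => by rw [hform x 0, hform x 1]; exact hp x⟩
  rcases e0 with ⟨a, b, c⟩ | ⟨a, b, c⟩ | ⟨a, b, c⟩ | ⟨a, b, c⟩ <;>
  rcases e1 with ⟨a', b', c'⟩ | ⟨a', b', c'⟩ | ⟨a', b', c'⟩ | ⟨a', b', c'⟩ <;>
  rw [a, a'] at h1 <;> norm_num at h1 <;> rw [a, b, c, a', b', c']
  · exact ⟨⟨false, false, false⟩, fun x => ⟨by simp [Pose.fst], by simp [Pose.snd]⟩⟩
  · exact ⟨⟨false, false, true⟩, fun x => ⟨by simp [Pose.fst], by simp [Pose.snd]; ring⟩⟩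
  · exact ⟨⟨false, true, false⟩, fun x => ⟨by simp [Pose.fst]; ring, by simp [Pose.snd]⟩⟩
  · exact ⟨⟨false, true, true⟩, fun x => ⟨by simp [Pose.fst]; ring, by simp [Pose.snd]; ring⟩⟩
  · exact ⟨⟨true, false, false⟩, fun x => ⟨by simp [Pose.fst], by simp [Pose.snd]⟩⟩
  · exact ⟨⟨true, false, true⟩, fun x => ⟨by simp [Pose.fst], by simp [Pose.snd]; ring⟩⟩
  · exact ⟨⟨true, true, false⟩, fun x => ⟨by simp [Pose.fst]; ring, by simp [Pose.snd]⟩⟩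
  · exact ⟨⟨true, true, true⟩, fun x => ⟨by simp [Pose.fst]; ring, by simp [Pose.snd]; ring⟩⟩

theorem exists_fromEnd_of_isometry (f : ℝ ≃ᵢ ℝ) (k : ℝ)
    (hf : f '' Icc k (k + 1) = Icc (0 : ℝ) 1) :
    ∃ r : Bool, ∀ w ∈ Icc (0 : ℝ) 1, f (k + fromEnd r w) = w := by
  have hmem : ∀ w ∈ Icc (0 : ℝ) 1, f (k + w) ∈ Icc (0 : ℝ) 1 := by
    intro w hw
    rw [← hf]
    exact mem_image_of_mem f ⟨by linarith [hw.1], by linarith [hw.2]⟩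
  have hd : ∀ a b : ℝ, |f a - f b| = |a - b| := fun a b => by
    rw [← Real.dist_eq, ← Real.dist_eq, f.dist_eq]
  obtain ⟨a0, a1⟩ := hmem 0 ⟨le_rfl, zero_le_one⟩
  obtain ⟨b0, b1⟩ := hmem 1 ⟨zero_le_one, le_rfl⟩
  have h01 := hd (k + 1) (k + 0)
  rw [show k + 1 - (k + 0) = 1 by ring, abs_one] at h01
  rcases (abs_eq zero_le_one).mp h01 with h | h
  · refine ⟨false, fun w hw => ?_⟩
    obtain ⟨c0, c1⟩ := hmem w hw
    have h2 := hd (k + w) (k + 0)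
    rw [show k + w - (k + 0) = w by ring, abs_of_nonneg hw.1, show f (k + 0) = 0 by linarith,
      sub_zero, abs_of_nonneg c0] at h2
    exact h2
  · refine ⟨true, fun w hw => ?_⟩
    have hw' := fromEnd_mem (r := true) hw
    obtain ⟨c0, c1⟩ := hmem _ hw'
    have h2 := hd (k + fromEnd true w) (k + 1)
    rw [show k + fromEnd true w - (k + 1) = -w by simp only [fromEnd, cond_true]; ring, abs_neg,
      abs_of_nonneg hw.1, show f (k + 1) = 0 by linarith, sub_zero, abs_of_nonneg c0] at h2
    exact h2

/-! ### Normalization of the position and of the base curve -/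

/-- Reflect the symmetry in the first coordinate if `σ` holds, and in the second if `τ` holds. -/
def Pose.reflect (p : Pose) (σ τ : Bool) : Pose := ⟨p.swap, p.flipX != σ, p.flipY != τ⟩

theorem Pose.fst_reflect (p : Pose) (σ τ : Bool) (x y : ℝ) :
    (p.reflect σ τ).fst 1 x y = bif σ then 1 - p.fst 1 x y else p.fst 1 x y := by
  rcases p with ⟨_ | _, _ | _, _ | _⟩ <;> cases σ <;> simp [Pose.reflect, Pose.fst]

theorem Pose.snd_reflect (p : Pose) (σ τ : Bool) (x y : ℝ) :
    (p.reflect σ τ).snd 1 x y = bif τ then 1 - p.snd 1 x y else p.snd 1 x y := by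
  rcases p with ⟨_ | _, _ | _, _ | _⟩ <;> cases τ <;> simp [Pose.reflect, Pose.snd]

/-- The coordinate with origin moved to `J - 16`, and reflected in `J` if `σ` holds. -/
def recenter (σ : Bool) (J : ℤ) (x : ℝ) : ℝ := 16 + bif σ then J - x else x - J

/-- The lower end of the segment onto which `recenter` takes `[z, z + 1]`. -/
def recenterCell (σ : Bool) (J z : ℤ) : ℤ := 16 + bif σ then J - 1 - z else z - J

theorem recenter_add (σ : Bool) (J z : ℤ) (x : ℝ) :
    recenter σ J (z + x) = recenterCell σ J z + bif σ then 1 - x else x := by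
  cases σ <;> simp [recenter, recenterCell] <;> ring

theorem recenterCell_injective (σ : Bool) (J : ℤ) : Function.Injective (recenterCell σ J) := by
  intro z w h
  cases σ <;> simp only [recenterCell, cond_true, cond_false] at h <;> omega

theorem recenter_sub_sq (σ : Bool) (J : ℤ) (x x' : ℝ) :
    (recenter σ J x - recenter σ J x') ^ 2 = (x - x') ^ 2 := by
  cases σ
  · simp [recenter]
  · simp only [recenter, cond_true]
    ring

theorem recenter_self (σ : Bool) (J : ℤ) : recenter σ J J = 16 := by
  cases σ <;> simp [recenter]

/-- A curve that consists of 32 copies of a base curve, and has a diagonal junction in the middle, has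
a dilation of at least `17/3`. -/
theorem exists_dilation_le_of_copies {gx gy X Y : ℝ → ℝ} {pose : ℕ → Pose} {zx zy : ℕ → ℤ}
    {rev : ℕ → Bool} {σ τ : Bool} {J K : ℤ}
    (hgx : ∀ u ∈ Icc (0 : ℝ) 1, gx u ∈ Icc (0 : ℝ) 1)
    (hgy : ∀ u ∈ Icc (0 : ℝ) 1, gy u ∈ Icc (0 : ℝ) 1)
    (honto : ∀ a ∈ Icc (0 : ℝ) 1, ∀ b ∈ Icc (0 : ℝ) 1, ∃ u ∈ Icc (0 : ℝ) 1, gx u = a ∧ gy u = b)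
    (hX : ∀ i : ℕ, i < 32 → ∀ u ∈ Icc (0 : ℝ) 1,
      X (i + u) = zx i + (pose i).fst 1 (gx (fromEnd (rev i) u)) (gy (fromEnd (rev i) u)))
    (hY : ∀ i : ℕ, i < 32 → ∀ u ∈ Icc (0 : ℝ) 1,
      Y (i + u) = zy i + (pose i).snd 1 (gx (fromEnd (rev i) u)) (gy (fromEnd (rev i) u)))
    (hright : ∀ i, 16 ≤ i → i < 32 → 16 ≤ recenterCell σ J (zx i) ∧ 16 ≤ recenterCell τ K (zy i))
    (hleft : ∀ i < 16, recenterCell σ J (zx i) < 16 ∧ recenterCell τ K (zy i) < 16)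
    (hinj : ∀ i j, i < j → j < 32 → ¬ (zx i = zx j ∧ zy i = zy j))
    (hXJ : X 16 = J) (hYK : Y 16 = K) :
    ∃ t t', 0 ≤ t ∧ t < t' ∧ t' ≤ 32 ∧
      17 * (t' - t) ≤ 3 * ((X t - X t') ^ 2 + (Y t - Y t') ^ 2) := by
  by_contra! hd
  set X' : ℝ → ℝ := fun t => recenter σ J (X t) with hX'
  set Y' : ℝ → ℝ := fun t => recenter τ K (Y t) with hY'
  set P : ℕ → Pose := fun i => (pose i).reflect σ τ with hP
  set cx : ℕ → ℤ := fun i => recenterCell σ J (zx i) with hcx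
  set cy : ℕ → ℤ := fun i => recenterCell τ K (zy i) with hcy
  have hX1 : ∀ i : ℕ, i < 32 → ∀ u ∈ Icc (0 : ℝ) 1,
      X' (i + u) = cx i + (P i).fst 1 (gx (fromEnd (rev i) u)) (gy (fromEnd (rev i) u)) := by
    intro i hi u hu
    simp only [hX', hX i hi u hu, recenter_add, hP, hcx, Pose.fst_reflect]
  have hY1 : ∀ i : ℕ, i < 32 → ∀ u ∈ Icc (0 : ℝ) 1,
      Y' (i + u) = cy i + (P i).snd 1 (gx (fromEnd (rev i) u)) (gy (fromEnd (rev i) u)) := by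
    intro i hi u hu
    simp only [hY', hY i hi u hu, recenter_add, hP, hcy, Pose.snd_reflect]
  have hX16 : X' 16 = 16 := by simp only [hX', hXJ, recenter_self]
  have hY16 : Y' 16 = 16 := by simp only [hY', hYK, recenter_self]
  have hd' : ∀ t t', 0 ≤ t → t < t' → t' ≤ 32 →
      3 * ((X' t - X' t') ^ 2 + (Y' t - Y' t') ^ 2) < 17 * (t' - t) := by
    intro t t' h0 h h1
    simp only [hX', hY', recenter_sub_sq]
    exact hd t t' h0 h h1
  -- The curve cannot move further than 10 from the junction in 16 units of time.
  have hfar : ∀ t, 0 ≤ t → t ≤ 32 → 1 ≤ X' t ∧ 1 ≤ Y' t := by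
    intro t h0 h1
    have : 3 * ((X' t - 16) ^ 2 + (Y' t - 16) ^ 2) ≤ 17 * 16 := by
      rcases lt_trichotomy t 16 with h | rfl | h
      · have := hd' t 16 h0 h (by norm_num)
        rw [hX16, hY16] at this
        linarith
      · rw [hX16, hY16]
        norm_num
      · have := hd' 16 t (by norm_num) h h1
        rw [hX16, hY16] at this
        nlinarith
    constructor <;> nlinarith [sq_nonneg (X' t - 16), sq_nonneg (Y' t - 16)]
  have hnonneg : ∀ i : ℕ, i < 32 → 0 ≤ cx i ∧ 0 ≤ cy i := by
    intro i hi
    have hi' : (i : ℝ) + 1 ≤ 32 := by exact_mod_cast hi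
    have hi0 : (0 : ℝ) ≤ i := i.cast_nonneg
    have h0 : (0 : ℝ) ∈ Icc (0 : ℝ) 1 := left_mem_Icc.mpr zero_le_one
    obtain ⟨h1, h2⟩ := hfar (i + 0) (by linarith) (by linarith)
    rw [hX1 i hi 0 h0] at h1
    rw [hY1 i hi 0 h0] at h2
    have h3 := ((P i).fst_mem_Icc (hgx _ (fromEnd_mem (r := rev i) h0))
      (hgy _ (fromEnd_mem (r := rev i) h0))).2
    have h4 := ((P i).snd_mem_Icc (hgx _ (fromEnd_mem (r := rev i) h0))
      (hgy _ (fromEnd_mem (r := rev i) h0))).2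
    constructor
    · have : (0 : ℝ) ≤ cx i := by linarith
      exact_mod_cast this
    · have : (0 : ℝ) ≤ cy i := by linarith
      exact_mod_cast this
  have hc16 : cx 16 = 16 ∧ cy 16 = 16 := by
    have h0 : (0 : ℝ) ∈ Icc (0 : ℝ) 1 := left_mem_Icc.mpr zero_le_one
    have h1 := hX1 16 (by norm_num) 0 h0
    have h2 := hY1 16 (by norm_num) 0 h0
    rw [show ((16 : ℕ) : ℝ) + 0 = 16 by norm_num] at h1 h2
    rw [hX16] at h1
    rw [hY16] at h2
    have h3 := ((P 16).fst_mem_Icc (hgx _ (fromEnd_mem (r := rev 16) h0))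
      (hgy _ (fromEnd_mem (r := rev 16) h0))).1
    have h4 := ((P 16).snd_mem_Icc (hgx _ (fromEnd_mem (r := rev 16) h0))
      (hgy _ (fromEnd_mem (r := rev 16) h0))).1
    obtain ⟨h5, h6⟩ := hright 16 le_rfl (by norm_num)
    constructor
    · refine le_antisymm ?_ h5
      have : ((cx 16 : ℤ) : ℝ) ≤ (16 : ℤ) := by push_cast; linarith
      exact_mod_cast this
    · refine le_antisymm ?_ h6
      have : ((cy 16 : ℤ) : ℝ) ≤ (16 : ℤ) := by push_cast; linarith
      exact_mod_cast this
  have hbX : ∀ u ∈ Icc (0 : ℝ) 1, X' (16 + u) - 16 =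
      (P 16).fst 1 (gx (fromEnd (rev 16) u)) (gy (fromEnd (rev 16) u)) := by
    intro u hu
    have := hX1 16 (by norm_num) u hu
    rw [hc16.1] at this
    push_cast at this
    linarith
  have hbY : ∀ u ∈ Icc (0 : ℝ) 1, Y' (16 + u) - 16 =
      (P 16).snd 1 (gx (fromEnd (rev 16) u)) (gy (fromEnd (rev 16) u)) := by
    intro u hu
    have := hY1 16 (by norm_num) u hu
    rw [hc16.2] at this
    push_cast at this
    linarith
  -- The base curve `(gx, gy)` is expressed by the copy between the times 16 and 17.
  have hinvX : ∀ w ∈ Icc (0 : ℝ) 1, gx w = (P 16).inv.fst 1 (X' (16 + fromEnd (rev 16) w) - 16)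
      (Y' (16 + fromEnd (rev 16) w) - 16) := by
    intro w hw
    rw [hbX _ (fromEnd_mem hw), hbY _ (fromEnd_mem hw), fromEnd_fromEnd, bne_self_eq_false,
      Pose.fst_inv]
    rfl
  have hinvY : ∀ w ∈ Icc (0 : ℝ) 1, gy w = (P 16).inv.snd 1 (X' (16 + fromEnd (rev 16) w) - 16)
      (Y' (16 + fromEnd (rev 16) w) - 16) := by
    intro w hw
    rw [hbX _ (fromEnd_mem hw), hbY _ (fromEnd_mem hw), fromEnd_fromEnd, bne_self_eq_false,
      Pose.snd_inv]
    rfl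
  have hcastX : ∀ i : ℕ, i < 32 → (((cx i).toNat : ℕ) : ℝ) = cx i := fun i hi => by
    exact_mod_cast congrArg (Int.cast : ℤ → ℝ) (Int.toNat_of_nonneg (hnonneg i hi).1)
  have hcastY : ∀ i : ℕ, i < 32 → (((cy i).toNat : ℕ) : ℝ) = cy i := fun i hi => by
    exact_mod_cast congrArg (Int.cast : ℤ → ℝ) (Int.toNat_of_nonneg (hnonneg i hi).2)
  exact NormalizedCurve.false
    { X := X'
      Y := Y'
      pose := fun i => (P i).mul (P 16).inv
      zx := fun i => (cx i).toNat
      zy := fun i => (cy i).toNat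
      rev := fun i => rev 16 != rev i
      copyX := fun i hi u hu => by
        rw [hX1 i hi u hu, hcastX i hi, Pose.fst_mul, hinvX _ (fromEnd_mem hu),
          hinvY _ (fromEnd_mem hu), fromEnd_fromEnd]
      copyY := fun i hi u hu => by
        rw [hY1 i hi u hu, hcastY i hi, Pose.snd_mul, hinvX _ (fromEnd_mem hu),
          hinvY _ (fromEnd_mem hu), fromEnd_fromEnd]
      pose_base := Pose.mul_inv _
      zx_base := by rw [hc16.1]; rfl
      zy_base := by rw [hc16.2]; rfl
      rev_base := bne_self_eq_false _
      quadrant_right := fun i h h' => by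
        have := hright i h h'
        simp only [hcx, hcy]
        omega
      quadrant_left := fun i h => by
        have := hleft i h
        simp only [hcx, hcy]
        omega
      injective := fun i j h h' e => by
        have h1 := hnonneg i (h.trans h')
        have h2 := hnonneg j h'
        exact hinj i j h h' ⟨recenterCell_injective σ J (by simp only [hcx, hcy] at *; omega),
          recenterCell_injective τ K (by simp only [hcx, hcy] at *; omega)⟩
      startX := hX16
      startY := hY16
      memX := fun u hu => by
        rw [hbX u hu]
        exact (P 16).fst_mem_Icc (hgx _ (fromEnd_mem hu)) (hgy _ (fromEnd_mem hu))
      memY := fun u hu => by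
        rw [hbY u hu]
        exact (P 16).snd_mem_Icc (hgx _ (fromEnd_mem hu)) (hgy _ (fromEnd_mem hu))
      onto := fun a ha b hb => by
        obtain ⟨w, hw, h1, h2⟩ := honto _ ((P 16).inv.fst_mem_Icc ha hb) _
          ((P 16).inv.snd_mem_Icc ha hb)
        refine ⟨fromEnd (rev 16) w, fromEnd_mem hw, ?_, ?_⟩
        · rw [hbX _ (fromEnd_mem hw), fromEnd_fromEnd, bne_self_eq_false]
          change (P 16).fst 1 (gx w) (gy w) = a
          rw [h1, h2, Pose.fst_fst_inv]
        · rw [hbY _ (fromEnd_mem hw), fromEnd_fromEnd, bne_self_eq_false]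
          change (P 16).snd 1 (gx w) (gy w) = b
          rw [h1, h2, Pose.snd_fst_inv]
      dilation := hd' }

/-! ### The fractions of a monofractal -/

namespace IsPeanoMonofractal

variable {s : ℕ} {γ : ℝ → EuclideanSpace ℝ (Fin 2)}

theorem mem_Icc (hγ : IsPeanoMonofractal s γ) {t : ℝ} (ht : t ∈ Icc (0 : ℝ) 1) :
    γ t 0 ∈ Icc (0 : ℝ) 1 ∧ γ t 1 ∈ Icc (0 : ℝ) 1 := by
  rw [← mem_unitCube_two, ← hγ.image_eq]
  exact mem_image_of_mem γ ht

theorem exists_eq (hγ : IsPeanoMonofractal s γ) {a b : ℝ} (ha : a ∈ Icc (0 : ℝ) 1)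
    (hb : b ∈ Icc (0 : ℝ) 1) : ∃ t ∈ Icc (0 : ℝ) 1, γ t 0 = a ∧ γ t 1 = b := by
  have : !₂[a, b] ∈ unitCube 2 := mem_unitCube_two.mpr ⟨by simpa using ha, by simpa using hb⟩
  rw [← hγ.image_eq] at this
  obtain ⟨t, ht, h⟩ := this
  exact ⟨t, ht, by simp [h], by simp [h]⟩

theorem base_pos (hγ : IsPeanoMonofractal s γ) : (0 : ℝ) < s := by
  exact_mod_cast lt_of_lt_of_le two_pos hγ.two_le

/-- The fraction number `m` of order `n` is a copy of the curve, placed in the lattice square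
`(zx, zy)` of side `s⁻ⁿ` by the symmetry `p` and traversed backwards if `r` holds. -/
def IsFractionCopy (s : ℕ) (γ : ℝ → EuclideanSpace ℝ (Fin 2)) (n m : ℕ) (p : Pose) (zx zy : ℤ)
    (r : Bool) : Prop :=
  ∀ u ∈ Icc (0 : ℝ) 1,
    (s : ℝ) ^ n * γ ((m + u) / ((s : ℝ) ^ 2) ^ n) 0 =
      zx + p.fst 1 (γ (fromEnd r u) 0) (γ (fromEnd r u) 1) ∧
    (s : ℝ) ^ n * γ ((m + u) / ((s : ℝ) ^ 2) ^ n) 1 =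
      zy + p.snd 1 (γ (fromEnd r u) 0) (γ (fromEnd r u) 1)

theorem exists_isFractionCopy_one (hγ : IsPeanoMonofractal s γ) {k : ℕ} (hk : k < s ^ 2) :
    ∃ (p : Pose) (zx zy : ℤ) (r : Bool), IsFractionCopy s γ 1 k p zx zy r := by
  obtain ⟨j, -, α, β, hα, hβ, h⟩ := hγ.fraction_similar k hk
  have hs := hγ.base_pos
  have hs2 : (0 : ℝ) < (s : ℝ) ^ 2 := by positivity
  have hmem : ∀ w ∈ Icc (0 : ℝ) 1, (k : ℝ) + w ∈ (s : ℝ) ^ 2 • timeSegment (s ^ 2) k := by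
    intro w hw
    refine Set.mem_smul_set.mpr ⟨(k + w) / (s : ℝ) ^ 2, ⟨?_, ?_⟩, ?_⟩
    · push_cast
      gcongr
      linarith [hw.1]
    · push_cast
      gcongr
      exact hw.2
    · rw [smul_eq_mul]
      field_simp
  have himage : α '' Icc (k : ℝ) (k + 1) = Icc (0 : ℝ) 1 := by
    rw [← hα]
    congr 1
    ext t
    constructor
    · intro ht
      have := hmem (t - k) ⟨by linarith [ht.1], by linarith [ht.2]⟩
      rwa [add_sub_cancel] at this
    · intro ht
      obtain ⟨v, ⟨h0, h1⟩, rfl⟩ := Set.mem_smul_set.mp ht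
      push_cast at h0 h1
      rw [div_le_iff₀ hs2] at h0
      rw [le_div_iff₀ hs2] at h1
      simp only [smul_eq_mul]
      constructor <;> linarith
  obtain ⟨r, hr⟩ := exists_fromEnd_of_isometry α k himage
  obtain ⟨p, hp⟩ := exists_pose_of_isometry β.symm (fun i => ((j i : ℕ) : ℝ)) (by
    intro x hx i
    rw [← hβ] at hx
    obtain ⟨y, hy, rfl⟩ := hx
    obtain ⟨z, hz, rfl⟩ := Set.mem_smul_set.mp hy
    obtain ⟨h0, h1⟩ := hz i
    rw [div_le_iff₀ hs] at h0
    rw [le_div_iff₀ hs] at h1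
    simp only [IsometryEquiv.symm_apply_apply, PiLp.smul_apply, smul_eq_mul]
    constructor <;> linarith)
  have key : ∀ u ∈ Icc (0 : ℝ) 1,
      (s : ℝ) • γ ((k + u) / (s : ℝ) ^ 2) = β.symm (γ (fromEnd r u)) := by
    intro u hu
    have hu' := fromEnd_mem (r := r) hu
    have h1 := h (k + u) (hmem u hu)
    have h2 := hr _ hu'
    rw [fromEnd_fromEnd, bne_self_eq_false, show fromEnd false u = u from rfl] at h2
    rw [h2] at h1
    rw [← h1, IsometryEquiv.symm_apply_apply]
  refine ⟨p, (j 0 : ℕ), (j 1 : ℕ), r, fun u hu => ?_⟩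
  obtain ⟨h1, h2⟩ := hp (γ (fromEnd r u))
  rw [← key u hu] at h1 h2
  rw [pow_one, pow_one]
  push_cast
  exact ⟨h1, h2⟩

/-- By induction: the fraction lies in one of order 1, which is a copy of the whole curve, and it is
there the copy of a fraction of order `n`, with its number counted from the end if the fraction of
order 1 is traversed backwards. -/
theorem exists_isFractionCopy (hγ : IsPeanoMonofractal s γ) (n : ℕ) :
    ∀ m < (s ^ 2) ^ n, ∃ (p : Pose) (zx zy : ℤ) (r : Bool), IsFractionCopy s γ n m p zx zy r := by
  have hs := hγ.base_pos
  have hs' : 0 < s := by exact_mod_cast hs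
  induction n with
  | zero =>
    intro m hm
    have hm0 : m = 0 := by simpa using hm
    subst hm0
    exact ⟨Pose.one, 0, 0, false, fun u _ => by simp [fromEnd, Pose.one, Pose.fst, Pose.snd]⟩
  | succ n ih =>
    intro m hm
    have hG : 0 < (s ^ 2) ^ n := by positivity
    obtain ⟨p₀, zx₀, zy₀, r₀, h₀⟩ := hγ.exists_isFractionCopy_one (k := m / (s ^ 2) ^ n)
      (Nat.div_lt_of_lt_mul (by rwa [← pow_succ]))
    have hlt := Nat.mod_lt m hG
    obtain ⟨p₁, zx₁, zy₁, r₁, h₁⟩ := ih (bif r₀ then (s ^ 2) ^ n - 1 - m % (s ^ 2) ^ n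
      else m % (s ^ 2) ^ n) (by
        cases r₀
        · exact hlt
        · exact (Nat.sub_le _ _).trans_lt (Nat.sub_lt hG one_pos))
    refine ⟨p₀.mul p₁, (s : ℤ) ^ n * zx₀ + p₀.fst ((s : ℤ) ^ n - 1) zx₁ zy₁,
      (s : ℤ) ^ n * zy₀ + p₀.snd ((s : ℤ) ^ n - 1) zx₁ zy₁, r₁ != r₀, fun u hu => ?_⟩
    set G : ℕ := (s ^ 2) ^ n with hGdef
    have hGR : ((s : ℝ) ^ 2) ^ n = G := by rw [hGdef]; push_cast; rfl
    have hGpos : (0 : ℝ) < G := by exact_mod_cast hG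
    have hmod : (m : ℝ) = G * (m / G : ℕ) + (m % G : ℕ) := by
      exact_mod_cast (Nat.div_add_mod m G).symm
    have hlt' : ((m % G : ℕ) : ℝ) + 1 ≤ G := by exact_mod_cast hlt
    set w : ℝ := ((m % G : ℕ) + u) / G with hw
    have hw1 : w ∈ Icc (0 : ℝ) 1 := by
      constructor
      · exact div_nonneg (add_nonneg (Nat.cast_nonneg _) hu.1) hGpos.le
      · rw [hw, div_le_one hGpos]
        linarith [hu.2]
    have ht : (m + u) / ((s : ℝ) ^ 2) ^ (n + 1) = ((m / G : ℕ) + w) / ((s : ℝ) ^ 2) ^ 1 := by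
      rw [pow_succ, hGR, pow_one, hw, hmod]
      field_simp
      ring
    have hw2 : fromEnd r₀ w = ((bif r₀ then G - 1 - m % G else m % G : ℕ) + fromEnd r₀ u) /
        ((s : ℝ) ^ 2) ^ n := by
      rw [hGR, hw]
      cases r₀
      · rfl
      · simp only [fromEnd, cond_true]
        rw [Nat.cast_sub (by omega), Nat.cast_sub (by omega)]
        field_simp
        push_cast
        ring
    obtain ⟨a0, b0⟩ := h₀ w hw1
    obtain ⟨a1, b1⟩ := h₁ (fromEnd r₀ u) (fromEnd_mem hu)
    rw [← hw2, fromEnd_fromEnd] at a1 b1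
    rw [ht]
    rw [pow_one] at a0 b0
    rw [pow_succ, mul_assoc, mul_assoc, a0, b0, mul_add, mul_add, Pose.mul_fst, Pose.mul_snd, a1, b1,
      Pose.fst_add, Pose.snd_add, Pose.fst_mul, Pose.snd_mul]
    push_cast [Pose.fst_intCast, Pose.snd_intCast]
    constructor <;> ring

end IsPeanoMonofractal

namespace IsPeanoMonofractal

variable {s : ℕ} {γ : ℝ → EuclideanSpace ℝ (Fin 2)}

theorem fraction_time_mem (hγ : IsPeanoMonofractal s γ) {n m : ℕ} (hm : m < (s ^ 2) ^ n) {u : ℝ}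
    (hu : u ∈ Icc (0 : ℝ) 1) : (m + u) / ((s : ℝ) ^ 2) ^ n ∈ Icc (0 : ℝ) 1 := by
  have hs := hγ.base_pos
  have hm' : (m : ℝ) + 1 ≤ ((s : ℝ) ^ 2) ^ n := by exact_mod_cast hm
  refine ⟨div_nonneg (add_nonneg m.cast_nonneg hu.1) (by positivity), ?_⟩
  rw [div_le_one (by positivity)]
  linarith [hu.2]

theorem exists_fraction_time (hγ : IsPeanoMonofractal s γ) (n : ℕ) {t : ℝ}
    (ht : t ∈ Icc (0 : ℝ) 1) :
    ∃ m < (s ^ 2) ^ n, ∃ u ∈ Icc (0 : ℝ) 1, t = (m + u) / ((s : ℝ) ^ 2) ^ n := by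
  have hs := hγ.base_pos
  have hG : (0 : ℝ) < ((s : ℝ) ^ 2) ^ n := by positivity
  have hG' : 0 < (s ^ 2) ^ n := by exact_mod_cast hG
  rcases ht.2.eq_or_lt with rfl | h1
  · refine ⟨(s ^ 2) ^ n - 1, Nat.sub_lt hG' one_pos, 1, right_mem_Icc.mpr zero_le_one, ?_⟩
    rw [Nat.cast_pred hG']
    push_cast
    rw [sub_add_cancel, div_self hG.ne']
  · have h0 : 0 ≤ t * ((s : ℝ) ^ 2) ^ n := mul_nonneg ht.1 hG.le
    refine ⟨⌊t * ((s : ℝ) ^ 2) ^ n⌋₊, ?_, t * ((s : ℝ) ^ 2) ^ n - ⌊t * ((s : ℝ) ^ 2) ^ n⌋₊,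
      ⟨sub_nonneg.mpr (Nat.floor_le h0), ?_⟩, ?_⟩
    · rw [Nat.floor_lt h0]
      push_cast
      nlinarith
    · linarith [Nat.lt_floor_add_one (t * ((s : ℝ) ^ 2) ^ n)]
    · rw [add_sub_cancel, mul_div_assoc, div_self hG.ne', mul_one]

/-- A fraction passes through the center of its square. -/
theorem IsFractionCopy.exists_center (hγ : IsPeanoMonofractal s γ) {n m : ℕ} {p : Pose}
    {zx zy : ℤ} {r : Bool} (h : IsFractionCopy s γ n m p zx zy r) :
    ∃ u ∈ Icc (0 : ℝ) 1, (s : ℝ) ^ n * γ ((m + u) / ((s : ℝ) ^ 2) ^ n) 0 = zx + 1 / 2 ∧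
      (s : ℝ) ^ n * γ ((m + u) / ((s : ℝ) ^ 2) ^ n) 1 = zy + 1 / 2 := by
  have hh : (1 / 2 : ℝ) ∈ Icc (0 : ℝ) 1 := by constructor <;> norm_num
  obtain ⟨t, ht, h0, h1⟩ := hγ.exists_eq hh hh
  obtain ⟨a, b⟩ := h _ (fromEnd_mem (r := r) ht)
  rw [fromEnd_fromEnd, bne_self_eq_false, show fromEnd false t = t from rfl, h0, h1] at a b
  refine ⟨fromEnd r t, fromEnd_mem ht, a.trans ?_, b.trans ?_⟩ <;> congr 1 <;>
    rcases p with ⟨_ | _, _ | _, _ | _⟩ <;> simp only [Pose.fst, Pose.snd, cond_true, cond_false] <;>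
    norm_num

/-- A fraction stays in its square. -/
theorem IsFractionCopy.mem_cell (hγ : IsPeanoMonofractal s γ) {n m : ℕ} {p : Pose}
    {zx zy : ℤ} {r : Bool} (h : IsFractionCopy s γ n m p zx zy r) {u : ℝ}
    (hu : u ∈ Icc (0 : ℝ) 1) :
    (s : ℝ) ^ n * γ ((m + u) / ((s : ℝ) ^ 2) ^ n) 0 ∈ Icc (zx : ℝ) (zx + 1) ∧
      (s : ℝ) ^ n * γ ((m + u) / ((s : ℝ) ^ 2) ^ n) 1 ∈ Icc (zy : ℝ) (zy + 1) := by
  obtain ⟨a, b⟩ := h u hu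
  obtain ⟨h0, h1⟩ := hγ.mem_Icc (fromEnd_mem (r := r) hu)
  obtain ⟨c0, c1⟩ := p.fst_mem_Icc h0 h1
  obtain ⟨d0, d1⟩ := p.snd_mem_Icc h0 h1
  rw [a, b]
  refine ⟨⟨?_, ?_⟩, ⟨?_, ?_⟩⟩ <;> linarith

/-- A fraction fills its square. -/
theorem IsFractionCopy.exists_eq (hγ : IsPeanoMonofractal s γ) {n m : ℕ} {p : Pose}
    {zx zy : ℤ} {r : Bool} (h : IsFractionCopy s γ n m p zx zy r) {a b : ℝ}
    (ha : a ∈ Icc (zx : ℝ) (zx + 1)) (hb : b ∈ Icc (zy : ℝ) (zy + 1)) :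
    ∃ u ∈ Icc (0 : ℝ) 1, (s : ℝ) ^ n * γ ((m + u) / ((s : ℝ) ^ 2) ^ n) 0 = a ∧
      (s : ℝ) ^ n * γ ((m + u) / ((s : ℝ) ^ 2) ^ n) 1 = b := by
  have ha' : a - zx ∈ Icc (0 : ℝ) 1 := ⟨by linarith [ha.1], by linarith [ha.2]⟩
  have hb' : b - zy ∈ Icc (0 : ℝ) 1 := ⟨by linarith [hb.1], by linarith [hb.2]⟩
  obtain ⟨t, ht, h0, h1⟩ := hγ.exists_eq (p.inv.fst_mem_Icc ha' hb') (p.inv.snd_mem_Icc ha' hb')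
  obtain ⟨c, d⟩ := h _ (fromEnd_mem (r := r) ht)
  rw [fromEnd_fromEnd, bne_self_eq_false, show fromEnd false t = t from rfl, h0, h1] at c d
  refine ⟨fromEnd r t, fromEnd_mem ht, c.trans ?_, d.trans ?_⟩
  · rw [Pose.fst_fst_inv]
    ring
  · rw [Pose.snd_fst_inv]
    ring

/-- The squares of a fraction and of a larger fraction that contains it. -/
theorem IsFractionCopy.cell_of_cell (hγ : IsPeanoMonofractal s γ) {n k m m' : ℕ} {p p' : Pose}
    {zx zy zx' zy' : ℤ} {r r' : Bool} (h : IsFractionCopy s γ (n + k) m p zx zy r)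
    (h' : IsFractionCopy s γ n m' p' zx' zy' r') (hle : m' * (s ^ 2) ^ k ≤ m)
    (hlt : m + 1 ≤ (m' + 1) * (s ^ 2) ^ k) :
    (zx' * s ^ k ≤ zx ∧ zx < (zx' + 1) * s ^ k) ∧
      (zy' * s ^ k ≤ zy ∧ zy < (zy' + 1) * s ^ k) := by
  have hs := hγ.base_pos
  have hk : (0 : ℝ) < ((s : ℝ) ^ 2) ^ k := by positivity
  have hq : (0 : ℝ) < (s : ℝ) ^ k := by positivity
  obtain ⟨u, hu, a, b⟩ := h.exists_center hγ
  have hle' : (m' : ℝ) * ((s : ℝ) ^ 2) ^ k ≤ m := by exact_mod_cast hle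
  have hlt' : (m : ℝ) + 1 ≤ (m' + 1) * ((s : ℝ) ^ 2) ^ k := by exact_mod_cast hlt
  have ht : (m + u) / ((s : ℝ) ^ 2) ^ (n + k) =
      (m' + ((m + u) / ((s : ℝ) ^ 2) ^ k - m')) / ((s : ℝ) ^ 2) ^ n := by
    rw [add_sub_cancel, div_div, pow_add, mul_comm]
  have hv : (m + u) / ((s : ℝ) ^ 2) ^ k - m' ∈ Icc (0 : ℝ) 1 := by
    constructor
    · rw [sub_nonneg, le_div_iff₀ hk]
      linarith [hu.1]
    · rw [sub_le_iff_le_add, div_le_iff₀ hk]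
      linarith [hu.2]
  obtain ⟨⟨c0, c1⟩, ⟨d0, d1⟩⟩ := h'.mem_cell hγ hv
  rw [← ht] at c0 c1 d0 d1
  rw [pow_add, mul_right_comm] at a b
  have aux : ∀ z z' : ℤ, ∀ x : ℝ, (z' : ℝ) ≤ x → x ≤ z' + 1 → x * (s : ℝ) ^ k = z + 1 / 2 →
      z' * s ^ k ≤ z ∧ z < (z' + 1) * s ^ k := by
    intro z z' x h0 h1 h2
    have h3 := mul_le_mul_of_nonneg_right h0 hq.le
    have h4 := mul_le_mul_of_nonneg_right h1 hq.le
    constructor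
    · have : ((z' * (s : ℤ) ^ k : ℤ) : ℝ) < ((z + 1 : ℤ) : ℝ) := by push_cast; linarith
      exact Int.lt_add_one_iff.mp (by exact_mod_cast this)
    · have : ((z : ℤ) : ℝ) < (((z' + 1) * (s : ℤ) ^ k : ℤ) : ℝ) := by push_cast; linarith
      exact_mod_cast this
  exact ⟨aux zx zx' _ c0 c1 a, aux zy zy' _ d0 d1 b⟩

/-- Distinct fractions of the same order fill distinct squares: there are as many squares as
fractions, and each square is filled by some fraction. -/
theorem cells_injOn (hγ : IsPeanoMonofractal s γ) {n : ℕ} {p : ℕ → Pose} {zx zy : ℕ → ℤ}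
    {r : ℕ → Bool} (h : ∀ m < (s ^ 2) ^ n, IsFractionCopy s γ n m (p m) (zx m) (zy m) (r m)) :
    Set.InjOn (fun m => (zx m, zy m)) (Finset.range ((s ^ 2) ^ n)) := by
  have hs := hγ.base_pos
  have hq : (0 : ℝ) < (s : ℝ) ^ n := by positivity
  have hmem : ∀ m < (s ^ 2) ^ n, zx m ∈ Finset.Ico (0 : ℤ) (s ^ n) ∧
      zy m ∈ Finset.Ico (0 : ℤ) (s ^ n) := by
    have aux : ∀ z : ℤ, ∀ x ∈ Icc (0 : ℝ) 1, (s : ℝ) ^ n * x = z + 1 / 2 →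
        z ∈ Finset.Ico (0 : ℤ) (s ^ n) := by
      intro z x hx hz
      rw [Finset.mem_Ico]
      constructor
      · have : (-1 : ℝ) < z := by nlinarith [hx.1]
        have : (-1 : ℤ) < z := by exact_mod_cast this
        omega
      · have : (z : ℝ) < (s : ℝ) ^ n := by nlinarith [hx.2]
        exact_mod_cast this
    intro m hm
    obtain ⟨u, hu, a, b⟩ := (h m hm).exists_center hγ
    obtain ⟨c, d⟩ := hγ.mem_Icc (hγ.fraction_time_mem hm hu)
    exact ⟨aux _ _ c a, aux _ _ d b⟩
  refine Finset.injOn_of_surjOn_of_card_le (t := Finset.Ico (0 : ℤ) (s ^ n) ×ˢ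
    Finset.Ico (0 : ℤ) (s ^ n)) _ ?_ ?_ ?_
  · intro m hm
    have := hmem m (by simpa using hm)
    simpa using this
  · rintro ⟨a, b⟩ hab
    have hab' : (0 ≤ a ∧ a < (s : ℤ) ^ n) ∧ (0 ≤ b ∧ b < (s : ℤ) ^ n) := by simpa using hab
    obtain ⟨⟨a0, a1⟩, ⟨b0, b1⟩⟩ := hab'
    have aux : ∀ z : ℤ, 0 ≤ z → z < (s : ℤ) ^ n →
        ((z : ℝ) + 1 / 2) / (s : ℝ) ^ n ∈ Icc (0 : ℝ) 1 := by
      intro z h0 h1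
      have h0' : (0 : ℝ) ≤ z := by exact_mod_cast h0
      have h1' : (z : ℝ) + 1 ≤ (s : ℝ) ^ n := by exact_mod_cast h1
      constructor
      · positivity
      · rw [div_le_one hq]
        linarith
    obtain ⟨t, ht, e0, e1⟩ := hγ.exists_eq (aux a a0 a1) (aux b b0 b1)
    obtain ⟨m, hm, u, hu, rfl⟩ := hγ.exists_fraction_time n ht
    obtain ⟨⟨c0, c1⟩, ⟨d0, d1⟩⟩ := (h m hm).mem_cell hγ hu
    rw [e0, mul_div_cancel₀ _ hq.ne'] at c0 c1
    rw [e1, mul_div_cancel₀ _ hq.ne'] at d0 d1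
    have key : ∀ z w : ℤ, (w : ℝ) ≤ z + 1 / 2 → (z : ℝ) + 1 / 2 ≤ w + 1 → w = z := by
      intro z w h0 h1
      have h2 : (w : ℝ) < ((z + 1 : ℤ) : ℝ) := by push_cast; linarith
      have h3 : (z : ℝ) < ((w + 1 : ℤ) : ℝ) := by push_cast; linarith
      have h2' : w < z + 1 := by exact_mod_cast h2
      have h3' : z < w + 1 := by exact_mod_cast h3
      omega
    exact ⟨m, by simpa using hm, Prod.ext (key a _ c0 c1) (key b _ d0 d1)⟩
  · rw [Finset.card_range, Finset.card_product, Int.card_Ico]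
    simp only [sub_zero]
    rw [show ((s : ℤ) ^ n).toNat = s ^ n by exact_mod_cast Int.toNat_natCast (s ^ n)]
    exact le_of_eq (by ring)

end IsPeanoMonofractal

/-! ### Diagonal junctions -/

/-- Two neighbours among the unit segments with integer ends, each divided into `c` parts, can be
moved to both sides of the coordinate `16`, with their common point at `16`. -/
theorem exists_recenter {z z' : ℤ} (h : z' = z + 1 ∨ z' = z - 1) (c : ℤ) :
    ∃ (σ : Bool) (J : ℤ),
      (∀ w, z' * c ≤ w → w < (z' + 1) * c → 16 ≤ recenterCell σ J w) ∧
      (∀ w, z * c ≤ w → w < (z + 1) * c → recenterCell σ J w < 16) ∧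
      ∀ x : ℝ, x ∈ Icc (z : ℝ) (z + 1) → x ∈ Icc (z' : ℝ) (z' + 1) → x * c = J := by
  rcases h with rfl | rfl
  · refine ⟨false, (z + 1) * c, fun w h0 h1 => ?_, fun w h0 h1 => ?_, fun x h0 h1 => ?_⟩
    · simp only [recenterCell, cond_false]
      omega
    · simp only [recenterCell, cond_false]
      omega
    · have : x = z + 1 := le_antisymm h0.2 (by simpa using h1.1)
      rw [this]
      push_cast
      ring
  · refine ⟨true, z * c, fun w h0 h1 => ?_, fun w h0 h1 => ?_, fun x h0 h1 => ?_⟩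
    · rw [sub_add_cancel] at h1
      simp only [recenterCell, cond_true]
      omega
    · simp only [recenterCell, cond_true]
      omega
    · have : x = z := le_antisymm (by simpa using h1.2) h0.1
      rw [this]
      push_cast
      ring

/-- If two squares of the lattice meet in a single point, then they are diagonal neighbours. -/
theorem diagonal_of_unique {a b a' b' : ℤ} {x y : ℝ} (hx : x ∈ Icc (a : ℝ) (a + 1))
    (hx' : x ∈ Icc (a' : ℝ) (a' + 1)) (hy : y ∈ Icc (b : ℝ) (b + 1))
    (hy' : y ∈ Icc (b' : ℝ) (b' + 1))
    (h : ∀ x₁ y₁ : ℝ, x₁ ∈ Icc (a : ℝ) (a + 1) → x₁ ∈ Icc (a' : ℝ) (a' + 1) →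
      y₁ ∈ Icc (b : ℝ) (b + 1) → y₁ ∈ Icc (b' : ℝ) (b' + 1) → x₁ = x ∧ y₁ = y) :
    (a' = a + 1 ∨ a' = a - 1) ∧ (b' = b + 1 ∨ b' = b - 1) := by
  have near : ∀ c c' : ℤ, ∀ z : ℝ, z ∈ Icc (c : ℝ) (c + 1) → z ∈ Icc (c' : ℝ) (c' + 1) → c ≠ c' →
      c' = c + 1 ∨ c' = c - 1 := by
    intro c c' z h0 h1 hne
    have h2 : ((c : ℤ) : ℝ) ≤ ((c' + 1 : ℤ) : ℝ) := by push_cast; linarith [h0.1, h1.2]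
    have h3 : ((c' : ℤ) : ℝ) ≤ ((c + 1 : ℤ) : ℝ) := by push_cast; linarith [h0.2, h1.1]
    have h2' : c ≤ c' + 1 := by exact_mod_cast h2
    have h3' : c' ≤ c + 1 := by exact_mod_cast h3
    omega
  have ends : ∀ c : ℤ, (c : ℝ) ∈ Icc (c : ℝ) (c + 1) ∧ (c : ℝ) + 1 ∈ Icc (c : ℝ) (c + 1) := fun c =>
    ⟨⟨le_rfl, by linarith⟩, ⟨by linarith, le_rfl⟩⟩
  constructor
  · refine near a a' x hx hx' ?_
    rintro rfl
    have h1 := (h a y (ends a).1 (ends a).1 hy hy').1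
    have h2 := (h (a + 1) y (ends a).2 (ends a).2 hy hy').1
    linarith
  · refine near b b' y hy hy' ?_
    rintro rfl
    have h1 := (h x b hx hx' (ends b).1 (ends b).1).2
    have h2 := (h x (b + 1) hx hx' (ends b).2 (ends b).2).2
    linarith

instance : Inhabited Pose := ⟨Pose.one⟩

namespace IsPeanoMonofractal

variable {s : ℕ} {γ : ℝ → EuclideanSpace ℝ (Fin 2)}

theorem mem_timeSegment (hγ : IsPeanoMonofractal s γ) (n m : ℕ) {u : ℝ} (hu : u ∈ Icc (0 : ℝ) 1) :
    (m + u) / ((s : ℝ) ^ 2) ^ n ∈ timeSegment ((s ^ 2) ^ n) m := by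
  have hs := hγ.base_pos
  simp only [timeSegment]
  push_cast
  constructor <;> gcongr
  · linarith [hu.1]
  · exact hu.2

theorem exists_of_mem_timeSegment (hγ : IsPeanoMonofractal s γ) {n m : ℕ} {t : ℝ}
    (ht : t ∈ timeSegment ((s ^ 2) ^ n) m) :
    ∃ u ∈ Icc (0 : ℝ) 1, t = (m + u) / ((s : ℝ) ^ 2) ^ n := by
  have hs := hγ.base_pos
  have hG : (0 : ℝ) < ((s : ℝ) ^ 2) ^ n := by positivity
  obtain ⟨h0, h1⟩ := ht
  push_cast at h0 h1
  rw [div_le_iff₀ hG] at h0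
  rw [le_div_iff₀ hG] at h1
  refine ⟨t * ((s : ℝ) ^ 2) ^ n - m, ⟨by linarith, by linarith⟩, ?_⟩
  rw [add_sub_cancel, mul_div_assoc, div_self hG.ne', mul_one]

/-- A fraction is the square in which it is placed. -/
theorem IsFractionCopy.mem_fraction_iff (hγ : IsPeanoMonofractal s γ) {n m : ℕ} {p : Pose}
    {zx zy : ℤ} {r : Bool} (h : IsFractionCopy s γ n m p zx zy r) (x : EuclideanSpace ℝ (Fin 2)) :
    x ∈ fraction γ (s ^ 2) n m ↔ (s : ℝ) ^ n * x 0 ∈ Icc (zx : ℝ) (zx + 1) ∧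
      (s : ℝ) ^ n * x 1 ∈ Icc (zy : ℝ) (zy + 1) := by
  have hq : (s : ℝ) ^ n ≠ 0 := (pow_pos hγ.base_pos n).ne'
  constructor
  · rintro ⟨t, ht, rfl⟩
    obtain ⟨u, hu, rfl⟩ := hγ.exists_of_mem_timeSegment ht
    exact h.mem_cell hγ hu
  · rintro ⟨hx, hy⟩
    obtain ⟨u, hu, h0, h1⟩ := h.exists_eq hγ hx hy
    refine ⟨_, hγ.mem_timeSegment n m hu, ?_⟩
    ext i
    fin_cases i
    · exact mul_left_cancel₀ hq h0
    · exact mul_left_cancel₀ hq h1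

/-- The consecutive fractions at a diagonal junction are diagonal neighbours. -/
theorem diagonal_cells (hγ : IsPeanoMonofractal s γ) {n m : ℕ} {p p' : Pose} {zx zy zx' zy' : ℤ}
    {r r' : Bool} (h : IsFractionCopy s γ n m p zx zy r)
    (h' : IsFractionCopy s γ n (m + 1) p' zx' zy' r') {c : EuclideanSpace ℝ (Fin 2)}
    (hc : fraction γ (s ^ 2) n m ∩ fraction γ (s ^ 2) n (m + 1) = {c}) :
    (zx' = zx + 1 ∨ zx' = zx - 1) ∧ (zy' = zy + 1 ∨ zy' = zy - 1) := by
  have hq : (s : ℝ) ^ n ≠ 0 := (pow_pos hγ.base_pos n).ne'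
  have hmem : c ∈ fraction γ (s ^ 2) n m ∩ fraction γ (s ^ 2) n (m + 1) := by rw [hc]; rfl
  obtain ⟨hc0, hc1⟩ := (h.mem_fraction_iff hγ c).mp hmem.1
  obtain ⟨hc0', hc1'⟩ := (h'.mem_fraction_iff hγ c).mp hmem.2
  refine diagonal_of_unique hc0 hc0' hc1 hc1' fun x₁ y₁ hx hx' hy hy' => ?_
  have h0 : (s : ℝ) ^ n * (!₂[x₁ / (s : ℝ) ^ n, y₁ / (s : ℝ) ^ n] : EuclideanSpace ℝ (Fin 2)) 0
      = x₁ := by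
    exact mul_div_cancel₀ _ hq
  have h1 : (s : ℝ) ^ n * (!₂[x₁ / (s : ℝ) ^ n, y₁ / (s : ℝ) ^ n] : EuclideanSpace ℝ (Fin 2)) 1
      = y₁ := by
    exact mul_div_cancel₀ _ hq
  have e : !₂[x₁ / (s : ℝ) ^ n, y₁ / (s : ℝ) ^ n] = c := by
    rw [← Set.mem_singleton_iff, ← hc]
    exact ⟨(h.mem_fraction_iff hγ _).mpr (by rw [h0, h1]; exact ⟨hx, hy⟩),
      (h'.mem_fraction_iff hγ _).mpr (by rw [h0, h1]; exact ⟨hx', hy'⟩)⟩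
  rw [e] at h0 h1
  exact ⟨h0.symm, h1.symm⟩

theorem exists_dilation_le (hγ : IsPeanoMonofractal s γ) (hdiag : HasDiagonalJunction γ (s ^ 2)) :
    ∃ t₁ t₂, 0 ≤ t₁ ∧ t₁ < t₂ ∧ t₂ ≤ 1 ∧ 17 * (t₂ - t₁) ≤ 3 * ‖γ t₁ - γ t₂‖ ^ 2 := by
  obtain ⟨n, m, -, hm, c, hc⟩ := hdiag
  have hs := hγ.base_pos
  have hs2 := hγ.two_le
  obtain ⟨p₀, zx₀, zy₀, r₀, h₀⟩ := hγ.exists_isFractionCopy n m (by omega)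
  obtain ⟨p₁, zx₁, zy₁, r₁, h₁⟩ := hγ.exists_isFractionCopy n (m + 1) hm
  obtain ⟨hdx, hdy⟩ := hγ.diagonal_cells h₀ h₁ hc
  choose! p zx zy r h using hγ.exists_isFractionCopy (n + 2)
  -- Two orders below the junction, at least 16 fractions on either side are available.
  have h16 : 16 ≤ (s ^ 2) ^ 2 := by
    rw [← pow_mul]
    exact Nat.pow_le_pow_left hs2 4
  set g : ℕ := (s ^ 2) ^ 2 with hg
  have hle : 16 ≤ (m + 1) * g := h16.trans (Nat.le_mul_of_pos_left g m.succ_pos)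
  obtain ⟨M, hM⟩ := Nat.exists_eq_add_of_le' hle
  have hMm : m * g ≤ M := by
    have : (m + 1) * g = m * g + g := Nat.succ_mul m g
    omega
  have hMN : M + 32 ≤ (s ^ 2) ^ (n + 2) := by
    have h1 : (m + 2) * g ≤ (s ^ 2) ^ n * g := Nat.mul_le_mul_right g hm
    have h2 : (m + 2) * g = (m + 1) * g + g := Nat.succ_mul (m + 1) g
    rw [pow_add, ← hg]
    omega
  have hleft : ∀ i < 16, (zx₀ * (s : ℤ) ^ 2 ≤ zx (M + i) ∧ zx (M + i) < (zx₀ + 1) * (s : ℤ) ^ 2) ∧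
      (zy₀ * (s : ℤ) ^ 2 ≤ zy (M + i) ∧ zy (M + i) < (zy₀ + 1) * (s : ℤ) ^ 2) := by
    intro i hi
    refine (h (M + i) (by omega)).cell_of_cell hγ h₀ ?_ ?_ <;> rw [← hg] <;> omega
  have hright : ∀ i, 16 ≤ i → i < 32 →
      (zx₁ * (s : ℤ) ^ 2 ≤ zx (M + i) ∧ zx (M + i) < (zx₁ + 1) * (s : ℤ) ^ 2) ∧
      (zy₁ * (s : ℤ) ^ 2 ≤ zy (M + i) ∧ zy (M + i) < (zy₁ + 1) * (s : ℤ) ^ 2) := by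
    intro i hi hi'
    have h2 : (m + 1 + 1) * g = (m + 1) * g + g := Nat.succ_mul (m + 1) g
    refine (h (M + i) (by omega)).cell_of_cell hγ h₁ ?_ ?_ <;> rw [← hg] <;> omega
  obtain ⟨σ, J, hσr, hσl, hσ⟩ := exists_recenter hdx ((s : ℤ) ^ 2)
  obtain ⟨τ, K, hτr, hτl, hτ⟩ := exists_recenter hdy ((s : ℤ) ^ 2)
  have hinj := hγ.cells_injOn h
  set G : ℝ := ((s : ℝ) ^ 2) ^ (n + 2) with hG
  have hGpos : 0 < G := by positivity
  -- The middle of the 32 fractions is the junction.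
  have hmid : (M + 16) / G = ((m + 1 : ℕ) + (0 : ℝ)) / ((s : ℝ) ^ 2) ^ n ∧
      (M + 16) / G = (m + (1 : ℝ)) / ((s : ℝ) ^ 2) ^ n := by
    have : (M : ℝ) + 16 = (m + 1) * ((s : ℝ) ^ 2) ^ 2 := by exact_mod_cast hM.symm
    rw [this, hG, pow_add]
    push_cast
    constructor <;> field_simp
    ring
  have hcell := h₁.mem_cell hγ (left_mem_Icc.mpr zero_le_one)
  have hcell' := h₀.mem_cell hγ (right_mem_Icc.mpr zero_le_one)
  rw [← hmid.1] at hcell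
  rw [← hmid.2] at hcell'
  have hJ : (s : ℝ) ^ (n + 2) * γ ((M + 16) / G) 0 = J := by
    rw [← hσ _ hcell'.1 hcell.1]
    push_cast
    ring
  have hK : (s : ℝ) ^ (n + 2) * γ ((M + 16) / G) 1 = K := by
    rw [← hτ _ hcell'.2 hcell.2]
    push_cast
    ring
  obtain ⟨t, t', h0, hlt, h1, hd⟩ := exists_dilation_le_of_copies
    (gx := fun u => γ u 0) (gy := fun u => γ u 1)
    (X := fun t => (s : ℝ) ^ (n + 2) * γ ((M + t) / G) 0)
    (Y := fun t => (s : ℝ) ^ (n + 2) * γ ((M + t) / G) 1)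
    (pose := fun i => p (M + i)) (zx := fun i => zx (M + i)) (zy := fun i => zy (M + i))
    (rev := fun i => r (M + i)) (σ := σ) (τ := τ) (J := J) (K := K)
    (fun u hu => (hγ.mem_Icc hu).1) (fun u hu => (hγ.mem_Icc hu).2)
    (fun a ha b hb => hγ.exists_eq ha hb)
    (fun i hi u hu => by
      have := (h (M + i) (by omega) u hu).1
      rw [← this]
      push_cast
      rw [add_assoc])
    (fun i hi u hu => by
      have := (h (M + i) (by omega) u hu).2
      rw [← this]
      push_cast
      rw [add_assoc])
    (fun i hi hi' => by
      obtain ⟨⟨c1, c2⟩, ⟨c3, c4⟩⟩ := hright i hi hi'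
      exact ⟨hσr _ c1 c2, hτr _ c3 c4⟩)
    (fun i hi => by
      obtain ⟨⟨c1, c2⟩, ⟨c3, c4⟩⟩ := hleft i hi
      exact ⟨hσl _ c1 c2, hτl _ c3 c4⟩)
    (fun i j hij hj e => by
      have := hinj (x₁ := M + i) (x₂ := M + j) (by simp; omega) (by simp; omega)
        (Prod.ext e.1 e.2)
      omega)
    hJ hK
  have hMG : (M : ℝ) + 32 ≤ G := by
    rw [hG]
    exact_mod_cast hMN
  refine ⟨(M + t) / G, (M + t') / G, by positivity, by gcongr, ?_, ?_⟩
  · rw [div_le_one hGpos]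
    linarith
  · have hGq : G = (s : ℝ) ^ (n + 2) * (s : ℝ) ^ (n + 2) := by
      rw [hG, ← pow_mul, ← pow_add]
      congr 1
      ring
    rw [sq_norm_eq_add]
    simp only [PiLp.sub_apply]
    rw [← sub_div, ← mul_div_assoc, div_le_iff₀ hGpos, show (M : ℝ) + t' - (M + t) = t' - t by ring]
    refine hd.trans (le_of_eq ?_)
    rw [hGq]
    ring

end IsPeanoMonofractal

/-- A plane Peano monofractal with a diagonal junction has Euclidean dilation at least `5 + 2/3`. -/
theorem theorem2 (s : ℕ) (γ : ℝ → EuclideanSpace ℝ (Fin 2))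
    (hγ : IsPeanoMonofractal s γ) (hdiag : HasDiagonalJunction γ (s ^ 2)) :
    ((5 + 2 / 3 : ℝ) : EReal) ≤ WD₂ γ := by
  obtain ⟨t₁, t₂, h0, hlt, h1, h⟩ := hγ.exists_dilation_le hdiag
  refine le_iSup_of_le t₁ (le_iSup_of_le t₂ (le_iSup_of_le ⟨h0, hlt, h1⟩ ?_))
  rw [EReal.coe_le_coe_iff, le_div_iff₀ (sub_pos.mpr hlt)]
  linarith
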